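/- **Setting.** Let $f,g:\mathbb{R}^p\times\mathbb{R}^q\to\mathbb{R}$ ($p,q\ge 1$) be continuously differentiable, with $\nabla_y g$ differentiable. Suppose that $\nabla_x f(\cdot,y)$, $\nabla_x f(x,\cdot)$, $\nabla_y f(\cdot,y)$, $\nabla_y f(x,\cdot)$ are Lipschitz with constants $L_x,L_{xy},L_{xy},L_y$; that $\nabla_y g(\cdot,y)$, $\nabla_y g(x,\cdot)$ are Lipschitz with constants $\widetilde L_{xy},\widetilde L_y$; that $\nabla_x\nabla_y g$, $\nabla_y^2 g$ are $\rho_{xy}$-, $\rho_{yy}$-Lipschitz in $(x,y)$; and that $g(x,\cdot)$ is $\mu_y$-strongly convex for every $x$ with $0<\mu_y\le\bar\mu$. Put $y^*(x)=\arg\min_y g(x,y)$ and $\Phi(x)=f(x,y^*(x))$. Suppose that $\Phi$ is convex and has a minimizer $x^*$ with $\|x^*\|=B>0$. Let $\epsilon>0$ and $$\Delta^*_{\rm CSC}=\|\nabla_y f(x^*,y^*(x^*))\|+\frac{\|x^*\|}{\mu_y}+\frac{(\|x^*\|+1)\sqrt{\Phi(0)-\Phi(x^*)}}{\sqrt{\epsilon}\,\mu_y}.$$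 **Algorithm.** AccBiO$(f,g;L_\Phi,\mu_x;M,N)$ starts from $x_0=z_0=0$. In iteration $k=0,1,\dots$, with $\kappa_y=\widetilde L_y/\mu_y$ and $\kappa_x=L_\Phi/\mu_x$: 1. it runs $N$ accelerated gradient steps from $y_k^0=s_k^0=0$, namely $y_k^t=s_k^{t-1}-\frac1{\widetilde L_y}\nabla_y g(x_k,s_k^{t-1})$, $s_k^t=\frac{2\sqrt{\kappa_y}}{\sqrt{\kappa_y}+1}y_k^t-\frac{\sqrt{\kappa_y}-1}{\sqrt{\kappa_y}+1}y_k^{t-1}$; 2. it computes $v_k^M$ by the heavy-ball method $v_k^{t+1}=v_k^t-\lambda\nabla Q(v_k^t)+\theta(v_k^t-v_k^{t-1})$, $v_k^0=v_k^1=0$, for $Q(v)=\frac12v^T\nabla_y^2g(x_k,y_k^N)v-v^T\nabla_y f(x_k,y_k^N)$, with $\lambda=\frac{4}{(\sqrt{\widetilde L_y}+\sqrt{\mu_y})^2}$ and $\theta=\max\{(1-\sqrt{\lambda\mu_y})^2,(1-\sqrt{\lambda\widetilde L_y})^2\}$; 3. with $G_k=\nabla_x f(x_k,y_k^N)-\nabla_x\nabla_y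 g(x_k,y_k^N)v_k^M$ it sets $z_{k+1}=x_k-\frac1{L_\Phi}G_k$ and $x_{k+1}=\big(1+\frac{\sqrt{\kappa_x}-1}{\sqrt{\kappa_x}+1}\big)z_{k+1}-\frac{\sqrt{\kappa_x}-1}{\sqrt{\kappa_x}+1}z_k$. Its complexity is $\tau(n_J+n_H)+n_G$, where $n_J,n_H,n_G$ count the Jacobian-vector products, Hessian-vector products and gradient evaluations made to compute $z_K$, and $\tau>0$ is a fixed constant. **Parameters.** For $R>0$ let $\widetilde f(x,y)=f(x,y)+\frac{\epsilon}{2R}\|x\|^2$, $\widetilde\Phi(x)=\widetilde f(x,y^*(x))$, $\widetilde x^*=\arg\min\widetilde\Phi$, $\mu_x=\epsilon/R$, and for an accuracy $\epsilon'$ put $$L_{\widetilde\Phi}(\epsilon')=L_x+\tfrac{\epsilon}{R}+\tfrac{2L_{xy}\widetilde L_{xy}}{\mu_y}+\tfrac{L_y\widetilde L_{xy}^2}{\mu_y^2}+\Gamma\,\|\nabla_y\widetilde f(\widetilde x^*,y^*(\widetilde x^*))\|+3\Gamma\Big(L_{xy}+\tfrac{L_y\widetilde L_{xy}}{\mu_y}\Big)\sqrt{\tfrac{2}{\mu_x}(\widetilde\Phi(0)-\widetilde\Phi(\widetilde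 x^*))+\|\widetilde x^*\|^2+\tfrac{\epsilon'}{\mu_x}},$$ with $\Gamma=\big(\tfrac{\widetilde L_{xy}\rho_{yy}}{\mu_y^2}+\tfrac{\rho_{xy}}{\mu_y}\big)\big(1+\tfrac{\widetilde L_{xy}}{\mu_y}\big)$. Let $$\ell=\log\Big(2+\epsilon+\tfrac1\epsilon+\tfrac1B+\tfrac1{\mu_y}+\widetilde L_y+\rho_{xy}+\rho_{yy}+\Delta^*_{\rm CSC}+\|y^*(x^*)\|\Big).$$ **Theorem (AccBiO, convex–strongly-convex).** There is a constant $C>0$ depending only on $L_x,L_{xy},L_y,\widetilde L_{xy},\tau$ and the upper bound $\bar\mu$ on $\mu_y$ such that, for all problems as above (in all dimensions) and all $\epsilon>0$: * *(Suboptimality gap)* Let $R=B^2$ and run AccBiO on $(\widetilde f,g)$ with $\mu_x=\epsilon/B^2$ and $L_\Phi=L_{\widetilde\Phi}(\epsilon/2)$. There are $K,M,N$ for which the complexity is at most $$C\,B\Big(\sqrt{\tfrac{\widetilde L_y}{\epsilon\mu_y^3}}+\Big(\sqrt{\tfrac{\rho_{yy}\widetilde L_y}{\epsilon\mu_y^4}}+\sqrt{\tfrac{\rho_{xy}\widetilde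 L_y}{\epsilon\mu_y^3}}\Big)\sqrt{\Delta^*_{\rm CSC}}\Big)\,\ell^2$$ and $\Phi(z_K)-\Phi(x^*)\le\epsilon$; the latter also holds for all larger $K,M,N$. * *(Gradient norm)* Let $R=B$. The equation $L=L_{\widetilde\Phi}\big(\epsilon^2/(4L+\frac{8\epsilon}{B})\big)$ has exactly one real solution $L$. Run AccBiO on $(\widetilde f,g)$ with $\mu_x=\epsilon/B$ and $L_\Phi=L$. There are $K,M,N$ for which the complexity is at most $$C\Big(\sqrt{\tfrac{B\widetilde L_y}{\epsilon\mu_y^3}}+\Big(\sqrt{\tfrac{B\rho_{yy}\widetilde L_y}{\epsilon\mu_y^4}}+\sqrt{\tfrac{B\rho_{xy}\widetilde L_y}{\epsilon\mu_y^3}}\Big)\sqrt{\Delta^*_{\rm CSC}}\Big)\,\ell^2$$ and $\Phi$ is differentiable at $z_K$ with $\|\nabla\Phi(z_K)\|\le5\epsilon$; the latter also holds for all larger $K,M,N$. -/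

import Mathlib

open Set

noncomputable section

/-- The Euclidean space `ℝⁿ`. -/
abbrev Euc (n : ℕ) : Type := EuclideanSpace ℝ (Fin n)

/-- A (chosen) minimizer of a real-valued function; an arbitrary point if there is none. -/
def argminPt {α : Type*} [Nonempty α] (h : α → ℝ) : α :=
  Classical.epsilon (fun a => ∀ b, h a ≤ h b)

section Derivatives

variable {p q : ℕ}

/-- The partial gradient `∇ₓ f (x, y)`. -/
def gradX (f : Euc p → Euc q → ℝ) (x : Euc p) (y : Euc q) : Euc p :=
  gradient (fun x' => f x' y) x

/-- The partial gradient `∇_y f (x, y)`. -/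
def gradY (f : Euc p → Euc q → ℝ) (x : Euc p) (y : Euc q) : Euc q :=
  gradient (fun y' => f x y') y

/-- The Hessian `∇²_y g (x, y)` as a linear operator on `ℝ^q`. -/
def hessYY (g : Euc p → Euc q → ℝ) (x : Euc p) (y : Euc q) : Euc q →L[ℝ] Euc q :=
  fderiv ℝ (fun y' => gradY g x y') y

/-- The `p × q` matrix `∇ₓ∇_y g (x, y) = (∂²g / ∂xᵢ∂yⱼ)` as a linear operator `ℝ^q → ℝ^p`:
the transpose of the derivative of `x ↦ ∇_y g (x, y)`. -/
def jacXY (g : Euc p → Euc q → ℝ) (x : Euc p) (y : Euc q) : Euc q →L[ℝ] Euc p :=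
  ContinuousLinearMap.adjoint (fderiv ℝ (fun x' => gradY g x' y) x)

/-- The inner-level solution `y*(x) = argmin_y g (x, y)`. -/
def innerSol (g : Euc p → Euc q → ℝ) (x : Euc p) : Euc q :=
  argminPt (g x)

/-- The total objective `Φ(x) = f (x, y*(x))`. -/
def totalObj (f g : Euc p → Euc q → ℝ) (x : Euc p) : ℝ :=
  f x (innerSol g x)

/-- The regularized outer-level function `f (x, y) + ε / (2R) ‖x‖²`. -/
def regularize (f : Euc p → Euc q → ℝ) (ε R : ℝ) (x : Euc p) (y : Euc q) : ℝ :=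
  f x y + ε / (2 * R) * ‖x‖ ^ 2

/-- The convex–strongly-convex bilevel class with smoothness parameters `Lx, Lxy, Ly` of `f`,
`Ltxy, Lty` of `g`, Lipschitz parameters `ρxy, ρyy` of the second-order derivatives of `g`, and
inner-level strong convexity parameter `μy`. The distance between `z₁ = (x₁, y₁)` and
`z₂ = (x₂, y₂)` is the Euclidean one. -/
structure IsConvexStronglyConvex (f g : Euc p → Euc q → ℝ)
    (Lx Lxy Ly Ltxy Lty ρxy ρyy μy : ℝ) : Prop where
  contDiff_f : ContDiff ℝ 1 (fun z : Euc p × Euc q => f z.1 z.2)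
  contDiff_g : ContDiff ℝ 1 (fun z : Euc p × Euc q => g z.1 z.2)
  differentiable_gradY_g : Differentiable ℝ (fun z : Euc p × Euc q => gradY g z.1 z.2)
  gradX_f_x : ∀ x₁ x₂ y, ‖gradX f x₁ y - gradX f x₂ y‖ ≤ Lx * ‖x₁ - x₂‖
  gradX_f_y : ∀ x y₁ y₂, ‖gradX f x y₁ - gradX f x y₂‖ ≤ Lxy * ‖y₁ - y₂‖
  gradY_f_x : ∀ x₁ x₂ y, ‖gradY f x₁ y - gradY f x₂ y‖ ≤ Lxy * ‖x₁ - x₂‖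
  gradY_f_y : ∀ x y₁ y₂, ‖gradY f x y₁ - gradY f x y₂‖ ≤ Ly * ‖y₁ - y₂‖
  gradY_g_x : ∀ x₁ x₂ y, ‖gradY g x₁ y - gradY g x₂ y‖ ≤ Ltxy * ‖x₁ - x₂‖
  gradY_g_y : ∀ x y₁ y₂, ‖gradY g x y₁ - gradY g x y₂‖ ≤ Lty * ‖y₁ - y₂‖
  jacXY_g : ∀ x₁ x₂ y₁ y₂, ‖jacXY g x₁ y₁ - jacXY g x₂ y₂‖ ≤
    ρxy * Real.sqrt (‖x₁ - x₂‖ ^ 2 + ‖y₁ - y₂‖ ^ 2)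
  hessYY_g : ∀ x₁ x₂ y₁ y₂, ‖hessYY g x₁ y₁ - hessYY g x₂ y₂‖ ≤
    ρyy * Real.sqrt (‖x₁ - x₂‖ ^ 2 + ‖y₁ - y₂‖ ^ 2)
  strongConvex_g : ∀ x, StrongConvexOn univ μy (g x)
  convex_totalObj : ConvexOn ℝ univ (totalObj f g)

end Derivatives

section Algorithm

variable {p q : ℕ}

/-- Numbers of gradient evaluations, Jacobian-vector and Hessian-vector products. -/
structure OracleCount where
  nG : ℕ
  nJ : ℕ
  nH : ℕ

/-- The complexity `τ (n_J + n_H) + n_G`. -/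
def OracleCount.cost (τ : ℝ) (c : OracleCount) : ℝ :=
  τ * ((c.nJ : ℝ) + (c.nH : ℝ)) + (c.nG : ℝ)

/-- State of the inner accelerated gradient descent: `y^t`, `s^t`, gradient evaluations so far. -/
structure AGDState (q : ℕ) where
  y : Euc q
  s : Euc q
  nG : ℕ

/-- Accelerated gradient descent on `g (x, ·)` from `y^0 = s^0 = 0`, with `κ_y = Lty / μy`. -/
def agd (g : Euc p → Euc q → ℝ) (Lty μy : ℝ) (x : Euc p) : ℕ → AGDState q
  | 0 => ⟨0, 0, 0⟩
  | t + 1 =>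
    let st := agd g Lty μy x t
    let r := Real.sqrt (Lty / μy)
    let y' := st.s - (1 / Lty) • gradY g x st.s
    ⟨y', (2 * r / (r + 1)) • y' - ((r - 1) / (r + 1)) • st.y, st.nG + 1⟩

/-- State of the heavy-ball method: `v^t`, `v^{t-1}`, Hessian-vector products so far. -/
structure HBState (q : ℕ) where
  v : Euc q
  vPrev : Euc q
  nH : ℕ

/-- Heavy-ball method with step sizes `lam, θ` on `Q(v) = ½ vᵀHv - vᵀb`, `∇Q(v) = Hv - b`, started
from `v^0 = v^1 = 0`. -/
def heavyBall (H : Euc q →L[ℝ] Euc q) (b : Euc q) (lam θ : ℝ) : ℕ → HBState q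
  | 0 => ⟨0, 0, 0⟩
  | 1 => ⟨0, 0, 0⟩
  | t + 2 =>
    let st := heavyBall H b lam θ (t + 1)
    ⟨st.v - lam • (H st.v - b) + θ • (st.v - st.vPrev), st.v, st.nH + 1⟩

/-- `λ = 4 / (√Lty + √μy)²`. -/
def hbLam (Lty μy : ℝ) : ℝ :=
  4 / (Real.sqrt Lty + Real.sqrt μy) ^ 2

/-- `θ = max {(1 - √(λ μy))², (1 - √(λ Lty))²}`. -/
def hbTheta (Lty μy : ℝ) : ℝ :=
  max ((1 - Real.sqrt (hbLam Lty μy * μy)) ^ 2) ((1 - Real.sqrt (hbLam Lty μy * Lty)) ^ 2)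

/-- State of AccBiO: `x_k`, `z_k`, and the oracle calls made to compute them. -/
structure AccBiOState (p : ℕ) where
  x : Euc p
  z : Euc p
  count : OracleCount

/-- AccBiO with outer-level function `f`, inner-level function `g`, `N` inner accelerated gradient
steps and `M` heavy-ball steps per outer iteration, outer step size `1 / LΦ`, `κ_x = LΦ / μx` and
`κ_y = Lty / μy`. Each outer iteration evaluates `∇_y g` in the inner loop, and `∇ₓ f`, `∇_y f` and
one Jacobian-vector product once each. -/
def accBiO (f g : Euc p → Euc q → ℝ) (Lty μy LΦ μx : ℝ) (M N : ℕ) : ℕ → AccBiOState p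
  | 0 => ⟨0, 0, ⟨0, 0, 0⟩⟩
  | k + 1 =>
    let st := accBiO f g Lty μy LΦ μx M N k
    let inner := agd g Lty μy st.x N
    let lin := heavyBall (hessYY g st.x inner.y) (gradY f st.x inner.y)
      (hbLam Lty μy) (hbTheta Lty μy) M
    let G := gradX f st.x inner.y - jacXY g st.x inner.y lin.v
    let r := Real.sqrt (LΦ / μx)
    let z' := st.x - (1 / LΦ) • G
    ⟨(1 + (r - 1) / (r + 1)) • z' - ((r - 1) / (r + 1)) • st.z, z',
      ⟨st.count.nG + inner.nG + 2, st.count.nJ + 1, st.count.nH + lin.nH⟩⟩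

/-- The smoothness parameter `L_Φ` used by AccBiO for the accuracy `ε` and an outer-level
function `f` with parameter `Lx`, `μx`-strongly convex total objective `Φ` and minimizer `x*`. -/
def smoothnessParam (f g : Euc p → Euc q → ℝ) (Lx Lxy Ly Ltxy ρxy ρyy μy μx ε : ℝ)
    (xs : Euc p) : ℝ :=
  Lx + 2 * Lxy * Ltxy / μy + Ly * Ltxy ^ 2 / μy ^ 2
    + (Ltxy * ρyy / μy ^ 2 + ρxy / μy) * (1 + Ltxy / μy) * ‖gradY f xs (innerSol g xs)‖
    + 3 * (Ltxy * ρyy / μy ^ 2 + ρxy / μy) * (1 + Ltxy / μy) * (Lxy + Ly * Ltxy / μy)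
      * Real.sqrt (2 / μx * (totalObj f g 0 - totalObj f g xs) + ‖xs‖ ^ 2 + ε / μx)

/-- The parameter `L_Φ̃` of the regularized problem: `Lx, f, x*, Φ` become
`Lx + ε/R, f̃, x̃*, Φ̃`, the strong convexity parameter is `μx = ε/R`, and the accuracy is `ε'`. -/
def regSmoothness (f g : Euc p → Euc q → ℝ) (Lx Lxy Ly Ltxy ρxy ρyy μy ε R ε' : ℝ) : ℝ :=
  smoothnessParam (regularize f ε R) g (Lx + ε / R) Lxy Ly Ltxy ρxy ρyy μy (ε / R) ε'
    (argminPt (totalObj (regularize f ε R) g))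

/-- `Δ*_CSC`. -/
def deltaCSC (f g : Euc p → Euc q → ℝ) (μy ε : ℝ) (xs : Euc p) : ℝ :=
  ‖gradY f xs (innerSol g xs)‖ + ‖xs‖ / μy
    + (‖xs‖ + 1) * Real.sqrt (totalObj f g 0 - totalObj f g xs) / (Real.sqrt ε * μy)

/-- The logarithmic factor hidden by `Õ`. -/
def logFactor (f g : Euc p → Euc q → ℝ) (Lty ρxy ρyy μy ε : ℝ) (xs : Euc p) : ℝ :=
  Real.log (2 + ε + 1 / ε + 1 / ‖xs‖ + 1 / μy + Lty + ρxy + ρyy + deltaCSC f g μy ε xs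
    + ‖innerSol g xs‖)

end Algorithm

end

/-!
Regularizing `f` by `ε / (2 R) ‖x‖²` makes the total objective `Φ` strongly convex, and AccBiO is
Nesterov's method for it with an inexact gradient oracle. The gradient of `Φ` is Lipschitz around a
point only with a constant that grows with `‖∇_y f‖` there. The Lyapunov energy of the method bounds
the distance of the iterates to the minimizer, so that all of them stay in a ball of fixed radius,
and the smoothness parameter of the algorithm is the Lipschitz constant which is valid on that ball.
The errors of the accelerated gradient and heavy-ball inner loops decay exponentially in `N` and
`M`. Since every other quantity is polynomial in the argument of `logFactor`, inner and outer
iteration numbers of the order of the square roots of the condition numbers times `logFactor`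
suffice. If the regularization dominates the smoothness of `Φ`, the outer condition number is
bounded, but then the starting point is already accurate enough.
-/

section Convex

variable {E : Type*} [NormedAddCommGroup E] [InnerProductSpace ℝ E] [CompleteSpace E]

lemma hasDerivAt_comp_add_smul {φ : E → ℝ} {g x u : E} {t : ℝ}
    (h : HasGradientAt φ g (x + t • u)) :
    HasDerivAt (fun s : ℝ => φ (x + s • u)) (inner ℝ g u) t := by
  have hline : HasDerivAt (fun s : ℝ => x + s • u) u t := by
    simpa using ((hasDerivAt_id t).smul_const u).const_add x
  exact (h.hasFDerivAt.comp_hasDerivAt t hline).congr_deriv (by simp)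

lemma add_inner_gradient_le_of_convexOn {φ : E → ℝ} (hφ : ConvexOn ℝ univ φ) {g x : E}
    (h : HasGradientAt φ g x) (u : E) : φ x + inner ℝ g (u - x) ≤ φ u := by
  have hderiv : HasDerivAt (fun s : ℝ => φ (x + s • (u - x))) (inner ℝ g (u - x)) 0 :=
    hasDerivAt_comp_add_smul (by simpa using h)
  have hconv : ConvexOn ℝ univ (fun s : ℝ => φ (x + s • (u - x))) :=
    (hφ.comp_affineMap (AffineMap.lineMap x u : ℝ →ᵃ[ℝ] E)).congr fun s _ => by
      simp [AffineMap.lineMap_apply, add_comm]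
  have hslope := hconv.le_slope_of_hasDerivAt (mem_univ 0) (mem_univ 1) zero_lt_one hderiv
  simp only [slope_def_field, one_smul, add_sub_cancel, zero_smul, add_zero, sub_zero,
    div_one] at hslope
  linarith

lemma add_inner_gradient_add_sq_le_of_strongConvexOn {φ : E → ℝ} {μ : ℝ}
    (hφ : StrongConvexOn univ μ φ) {g x : E} (h : HasGradientAt φ g x) (u : E) :
    φ x + inner ℝ g (u - x) + μ / 2 * ‖u - x‖ ^ 2 ≤ φ u := by
  have hgrad : HasGradientAt (fun y => φ y - μ / 2 * ‖y‖ ^ 2) (g - μ • x) x := by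
    rw [hasGradientAt_iff_hasFDerivAt]
    refine (h.hasFDerivAt.sub ((hasStrictFDerivAt_norm_sq x).hasFDerivAt.const_mul
      (μ / 2))).congr_fderiv ?_
    ext v
    simp only [sub_apply, InnerProductSpace.toDual_apply_apply,
      smul_apply, innerSL_apply_apply, map_sub, map_smul, smul_eq_mul]
    ring
  have hlin := add_inner_gradient_le_of_convexOn (strongConvexOn_iff_convex.1 hφ) hgrad u
  have hsq : ‖u - x‖ ^ 2 = ‖u‖ ^ 2 - 2 * inner ℝ x u + ‖x‖ ^ 2 := by
    rw [norm_sub_sq_real, real_inner_comm]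
  simp only [inner_sub_left, inner_sub_right, real_inner_smul_left,
    real_inner_self_eq_norm_sq] at hlin ⊢
  rw [hsq]
  linarith

lemma sq_norm_sub_le_of_strongConvexOn {φ : E → ℝ} {μ : ℝ} (hφ : StrongConvexOn univ μ φ)
    {a : E} (ha : HasGradientAt φ 0 a) (u : E) : μ / 2 * ‖u - a‖ ^ 2 ≤ φ u - φ a := by
  have := add_inner_gradient_add_sq_le_of_strongConvexOn hφ ha u
  rw [inner_zero_left] at this
  linarith

lemma mul_sq_norm_sub_le_inner_of_strongConvexOn {φ : E → ℝ} {φ' : E → E} {μ : ℝ}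
    (hφ : StrongConvexOn univ μ φ) (hgrad : ∀ x, HasGradientAt φ (φ' x) x) (u v : E) :
    μ * ‖u - v‖ ^ 2 ≤ inner ℝ (φ' u - φ' v) (u - v) := by
  have huv := add_inner_gradient_add_sq_le_of_strongConvexOn hφ (hgrad u) v
  have hvu := add_inner_gradient_add_sq_le_of_strongConvexOn hφ (hgrad v) u
  rw [norm_sub_rev, ← neg_sub u v, inner_neg_right] at huv
  rw [inner_sub_left]
  linarith

lemma le_add_inner_gradient_add_sq {φ : E → ℝ} {φ' : E → E}
    (hgrad : ∀ x, HasGradientAt φ (φ' x) x) {L : ℝ} {x : E}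
    (hL : ∀ u, ‖φ' u - φ' x‖ ≤ L * ‖u - x‖) (u : E) :
    φ u ≤ φ x + inner ℝ (φ' x) (u - x) + L / 2 * ‖u - x‖ ^ 2 := by
  set v := u - x with hv
  let ψ : ℝ → ℝ := fun t => φ (x + t • v) - t * inner ℝ (φ' x) v - L / 2 * t ^ 2 * ‖v‖ ^ 2
  have hderiv (t : ℝ) : HasDerivAt ψ
      (inner ℝ (φ' (x + t • v) - φ' x) v - L * t * ‖v‖ ^ 2) t := by
    refine (((hasDerivAt_comp_add_smul (hgrad _)).sub
      ((hasDerivAt_id t).mul_const (inner ℝ (φ' x) v : ℝ))).sub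
      (((hasDerivAt_pow 2 t).const_mul (L / 2)).mul_const (‖v‖ ^ 2))).congr_deriv ?_
    rw [inner_sub_left]
    push_cast
    ring
  have hnonpos {t : ℝ} (ht : 0 ≤ t) :
      inner ℝ (φ' (x + t • v) - φ' x) v - L * t * ‖v‖ ^ 2 ≤ 0 := by
    have hLt := hL (x + t • v)
    rw [add_sub_cancel_left, norm_smul, Real.norm_of_nonneg ht] at hLt
    have := (real_inner_le_norm _ v).trans (mul_le_mul_of_nonneg_right hLt (norm_nonneg v))
    linarith
  have hanti : AntitoneOn ψ (Icc 0 1) := by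
    refine antitoneOn_of_deriv_nonpos (convex_Icc 0 1)
      (fun t _ => (hderiv t).continuousAt.continuousWithinAt)
      (fun t _ => (hderiv t).differentiableAt.differentiableWithinAt) fun t ht => ?_
    rw [interior_Icc] at ht
    rw [(hderiv t).deriv]
    exact hnonpos ht.1.le
  have := hanti (left_mem_Icc.2 zero_le_one) (right_mem_Icc.2 zero_le_one) zero_le_one
  simp only [ψ, hv, one_smul, add_sub_cancel, one_mul, one_pow, mul_one, zero_smul, add_zero,
    zero_mul, sub_zero, ne_eq, OfNat.ofNat_ne_zero, not_false_eq_true, zero_pow, mul_zero] at this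
  linarith

lemma sq_norm_gradient_le_of_forall_le {φ : E → ℝ} {φ' : E → E}
    (hgrad : ∀ x, HasGradientAt φ (φ' x) x) {L : ℝ} (hL₀ : 0 < L) {x : E}
    (hL : ∀ u, ‖φ' u - φ' x‖ ≤ L * ‖u - x‖) {a : E} (hmin : ∀ u, φ a ≤ φ u) :
    ‖φ' x‖ ^ 2 ≤ 2 * L * (φ x - φ a) := by
  have hstep := (hmin _).trans (le_add_inner_gradient_add_sq hgrad hL (x - L⁻¹ • φ' x))
  rw [sub_sub_cancel_left, inner_neg_right, real_inner_smul_right, real_inner_self_eq_norm_sq,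
    norm_neg, norm_smul, Real.norm_of_nonneg (by positivity)] at hstep
  have hdecrease : ‖φ' x‖ ^ 2 / (2 * L) ≤ φ x - φ a := by
    have : L⁻¹ * ‖φ' x‖ ^ 2 - L / 2 * (L⁻¹ * ‖φ' x‖) ^ 2 = ‖φ' x‖ ^ 2 / (2 * L) := by
      field_simp
      ring
    linarith
  rwa [div_le_iff₀' (by positivity)] at hdecrease

lemma argminPt_le {α : Type*} [Nonempty α] {h : α → ℝ} (hex : ∃ a, ∀ b, h a ≤ h b) (b : α) :
    h (argminPt h) ≤ h b :=
  Classical.epsilon_spec (p := fun a => ∀ b, h a ≤ h b) hex b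

lemma gradient_eq_zero_of_forall_le {φ : E → ℝ} {a : E} (hmin : ∀ b, φ a ≤ φ b) :
    gradient φ a = 0 := by
  have : IsLocalMin φ a := Filter.Eventually.of_forall hmin
  rw [gradient, this.fderiv_eq_zero, map_zero]

lemma exists_forall_le_of_strongConvexOn [ProperSpace E] {φ : E → ℝ} {μ : ℝ} (hμ : 0 < μ)
    (hφ : StrongConvexOn univ μ φ) (hd : Differentiable ℝ φ) : ∃ a, ∀ b, φ a ≤ φ b := by
  set g := gradient φ 0
  have hlower (u : E) : φ 0 + ‖u‖ * (μ / 2 * ‖u‖ - ‖g‖) ≤ φ u := by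
    have hquad := add_inner_gradient_add_sq_le_of_strongConvexOn hφ (hd 0).hasGradientAt u
    have hcs := (abs_le.1 (abs_real_inner_le_norm g u)).1
    rw [sub_zero] at hquad
    linarith
  have htop : Filter.Tendsto (fun t : ℝ => φ 0 + t * (μ / 2 * t - ‖g‖)) Filter.atTop
      Filter.atTop :=
    Filter.tendsto_atTop_add_const_left _ _ (Filter.tendsto_id.atTop_mul_atTop₀
      (Filter.tendsto_atTop_add_const_right _ _
        (Filter.tendsto_id.const_mul_atTop (half_pos hμ))))
  exact hd.continuous.exists_forall_le <|
    Filter.tendsto_atTop_mono hlower (htop.comp tendsto_norm_cocompact_atTop)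

end Convex

section AcceleratedGradient

variable {E : Type*} [NormedAddCommGroup E] [InnerProductSpace ℝ E]

/-- The Lyapunov energy of the accelerated gradient method with momentum `(r - 1) / (r + 1)` for a
`μ`-strongly convex function `φ` with minimizer `xs`: its decay controls both the function value
and the distance to the minimizer. Here `r` is the square root of the condition number. -/
noncomputable def nesterovEnergy (φ : E → ℝ) (xs : E) (μ r : ℝ) (x z : E) : ℝ :=
  φ z - φ xs + μ / 2 * ‖(x - xs) + r • (x - z)‖ ^ 2

lemma nesterovEnergy_self (φ : E → ℝ) (xs : E) (μ r : ℝ) (x : E) :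
    nesterovEnergy φ xs μ r x x = φ x - φ xs + μ / 2 * ‖x - xs‖ ^ 2 := by
  simp [nesterovEnergy]

lemma sub_le_nesterovEnergy (φ : E → ℝ) (xs : E) {μ : ℝ} (hμ : 0 ≤ μ) (r : ℝ) (x z : E) :
    φ z - φ xs ≤ nesterovEnergy φ xs μ r x z :=
  le_add_of_nonneg_right (by positivity)

lemma norm_sub_le_of_nesterovEnergy_le [CompleteSpace E] {φ : E → ℝ} {xs : E} {μ r D c : ℝ}
    {x z : E} (hμ : 0 < μ) (hD : 0 ≤ D) (hφ : StrongConvexOn univ μ φ)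
    (hxs : HasGradientAt φ 0 xs) (hc : 2 / μ * c ≤ D ^ 2)
    (hle : nesterovEnergy φ xs μ r x z ≤ c) : ‖z - xs‖ ≤ D := by
  refine abs_le_of_sq_le_sq' (le_trans ?_ hc) hD |>.2
  rw [div_mul_eq_mul_div, le_div_iff₀ hμ]
  linarith [sq_norm_sub_le_of_strongConvexOn hφ hxs z, sub_le_nesterovEnergy φ xs hμ.le r x z]

lemma add_smul_sub_of_nesterov_step {xs x z x' z' w : E} {r : ℝ} (hr : r + 1 ≠ 0)
    (hz : z' = x - w)
    (hx : x' = (1 + (r - 1) / (r + 1)) • z' - ((r - 1) / (r + 1)) • z) :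
    (x' - xs) + r • (x' - z') = r • ((x - xs) - w) - (r - 1) • (z - xs) := by
  have hmom : x' - z' = ((r - 1) / (r + 1)) • (z' - z) := by rw [hx]; module
  calc (x' - xs) + r • (x' - z') = (z' - xs) + (r + 1) • (x' - z') := by module
    _ = (z' - xs) + (r - 1) • (z' - z) := by rw [hmom, smul_smul, mul_div_cancel₀ _ hr]
    _ = r • ((x - xs) - w) - (r - 1) • (z - xs) := by rw [hz]; module

lemma nesterov_momentum_identity (X Z G : E) {r μ : ℝ} (hr : r ≠ 0) (hμ : μ ≠ 0) :
    μ / 2 * ‖r • (X - (1 / (μ * r ^ 2)) • G) - (r - 1) • Z‖ ^ 2 + μ / 2 * (r - 1) * ‖X - Z‖ ^ 2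
      = (1 - 1 / r) * (μ / 2 * ‖X + r • (X - Z)‖ ^ 2) + 1 / r * (μ / 2 * ‖X‖ ^ 2)
        - inner ℝ G ((1 - 1 / r) • (X - Z) + (1 / r) • X) + ‖G‖ ^ 2 / (2 * (μ * r ^ 2)) := by
  simp only [← real_inner_self_eq_norm_sq, inner_add_left, inner_add_right, inner_sub_left,
    inner_sub_right, real_inner_smul_left, inner_smul_right]
  rw [real_inner_comm X Z, real_inner_comm X G, real_inner_comm Z G]
  field_simp
  ring

/-- Strong convexity at `x` is used towards `z` with weight `1 - 1 / r` and towards `xs` with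
weight `1 / r`; the momentum is chosen so that the inner products with `G` then cancel. -/
lemma nesterovEnergy_step_le [CompleteSpace E] {φ : E → ℝ} {φ' : E → E} {xs x z x' z' G : E}
    {r μ : ℝ} (hr : 1 ≤ r) (hμ : 0 < μ) (hφ : StrongConvexOn univ μ φ)
    (hgrad : ∀ x, HasGradientAt φ (φ' x) x)
    (hsm : ∀ u, ‖φ' u - φ' x‖ ≤ μ * r ^ 2 * ‖u - x‖)
    (hz : z' = x - (1 / (μ * r ^ 2)) • G)
    (hx : x' = (1 + (r - 1) / (r + 1)) • z' - ((r - 1) / (r + 1)) • z) :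
    nesterovEnergy φ xs μ r x' z' ≤ (1 - 1 / r) * nesterovEnergy φ xs μ r x z
      + inner ℝ (G - φ' x) ((1 - 1 / r) • (z - xs) - (z' - xs)) := by
  have hr₀ : 0 < r := by linarith
  have hα : 0 ≤ 1 - 1 / r := by rw [sub_nonneg, div_le_one hr₀]; exact hr
  have hdesc := le_add_inner_gradient_add_sq hgrad hsm z'
  have hcz := mul_le_mul_of_nonneg_left
    (add_inner_gradient_add_sq_le_of_strongConvexOn hφ (hgrad x) z) hα
  have hcxs := mul_le_mul_of_nonneg_left
    (add_inner_gradient_add_sq_le_of_strongConvexOn hφ (hgrad x) xs) (one_div_nonneg.2 hr₀.le)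
  have hid := nesterov_momentum_identity (x - xs) (z - xs) G hr₀.ne' hμ.ne'
  rw [sub_sub_sub_cancel_right, ← add_smul_sub_of_nesterov_step (by linarith) hz hx] at hid
  have hnonneg : 0 ≤ μ / 2 * (r - 1) * ‖x - z‖ ^ 2 + (1 - 1 / r) * (μ / 2 * ‖x - z‖ ^ 2) := by
    have : 0 ≤ r - 1 := by linarith
    positivity
  have hzx : z' - x = -((1 / (μ * r ^ 2)) • G) := by rw [hz]; abel
  have hzxs : z' - xs = (x - xs) - (1 / (μ * r ^ 2)) • G := by rw [hz]; abel
  have hsplit : z - xs = (x - xs) - (x - z) := by abel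
  have hsq : μ * r ^ 2 / 2 * ((1 / (μ * r ^ 2)) ^ 2 * ‖G‖ ^ 2)
      = ‖G‖ ^ 2 / (2 * (μ * r ^ 2)) := by field_simp
  have hlin : 1 / (μ * r ^ 2) * ‖G‖ ^ 2 = 2 * (‖G‖ ^ 2 / (2 * (μ * r ^ 2))) := by field_simp
  rw [nesterovEnergy, nesterovEnergy, hzxs, hsplit]
  rw [hzx] at hdesc
  rw [← neg_sub x z, norm_neg, inner_neg_right] at hcz
  rw [← neg_sub x xs, norm_neg, inner_neg_right] at hcxs
  simp only [norm_neg, norm_smul, mul_pow, Real.norm_eq_abs, sq_abs, inner_neg_right,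
    inner_sub_left, inner_sub_right, inner_add_right, inner_smul_right,
    real_inner_self_eq_norm_sq, hsq] at hdesc hcz hcxs hid ⊢
  linarith

lemma norm_gradient_step_sub_le {φ' : E → E} {xs x z' G : E} {L D δ : ℝ} (hL : 0 < L)
    (hsm : ∀ u, ‖φ' u - φ' x‖ ≤ L * ‖u - x‖) (hxs : φ' xs = 0) (hxD : ‖x - xs‖ ≤ D)
    (hG : ‖G - φ' x‖ ≤ δ) (hz : z' = x - (1 / L) • G) : ‖z' - xs‖ ≤ 2 * D + δ / L := by
  have hgrad : ‖φ' x‖ ≤ L * D := by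
    have := hsm xs
    rw [hxs, zero_sub, norm_neg, norm_sub_rev] at this
    exact this.trans (mul_le_mul_of_nonneg_left hxD hL.le)
  have hGn : ‖G‖ ≤ δ + L * D := by
    simpa using (norm_add_le (G - φ' x) (φ' x)).trans (add_le_add hG hgrad)
  calc ‖z' - xs‖ = ‖(x - xs) - (1 / L) • G‖ := by rw [hz]; congr 1; abel
    _ ≤ D + 1 / L * (δ + L * D) := by
      refine (norm_sub_le _ _).trans (add_le_add hxD ?_)
      rw [norm_smul, Real.norm_of_nonneg (by positivity)]
      gcongr
    _ = 2 * D + δ / L := by field_simp; ring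

lemma norm_momentum_sub_le {xs z z' x' : E} {r D : ℝ} (hr : 1 ≤ r) (hz : ‖z - xs‖ ≤ D)
    (hz' : ‖z' - xs‖ ≤ D)
    (hx : x' = (1 + (r - 1) / (r + 1)) • z' - ((r - 1) / (r + 1)) • z) : ‖x' - xs‖ ≤ 3 * D := by
  set β := (r - 1) / (r + 1)
  have hβ : 0 ≤ β := div_nonneg (by linarith) (by linarith)
  have hβ_le : β ≤ 1 := div_le_one_of_le₀ (by linarith) (by linarith)
  have hD : 0 ≤ D := (norm_nonneg _).trans hz
  calc ‖x' - xs‖ = ‖(1 + β) • (z' - xs) - β • (z - xs)‖ := by rw [hx]; congr 1; module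
    _ ≤ (1 + β) * D + β * D := by
      refine (norm_sub_le _ _).trans ?_
      rw [norm_smul, norm_smul, Real.norm_of_nonneg hβ, Real.norm_of_nonneg (by linarith)]
      gcongr
    _ ≤ 3 * D := by nlinarith

lemma inner_smul_sub_le {a b e : E} {α D D' δ : ℝ} (hα : 0 ≤ α) (hα_le : α ≤ 1)
    (he : ‖e‖ ≤ δ) (ha : ‖a‖ ≤ D) (hb : ‖b‖ ≤ D') :
    inner ℝ e (α • a - b) ≤ δ * (D + D') := by
  have hnorm : ‖α • a - b‖ ≤ D + D' := by
    refine (norm_sub_le _ _).trans (add_le_add ?_ hb)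
    rw [norm_smul, Real.norm_of_nonneg hα]
    exact (mul_le_of_le_one_left (norm_nonneg a) hα_le).trans ha
  exact (real_inner_le_norm _ _).trans
    (mul_le_mul he hnorm (norm_nonneg _) ((norm_nonneg e).trans he))

variable [CompleteSpace E]

/-- Accelerated gradient descent with an inexact gradient oracle `G` for a `μ`-strongly convex `φ`
with gradient `φ'` and minimizer `xs`. Smoothness, with constant `μ r²`, and accuracy `δ` of the
oracle are needed only at base points in the ball of radius `3 D` about `xs`, in which the iterates
stay because the energy does not exceed its initial value by more than `η`. -/
structure InexactNesterov (φ : E → ℝ) (φ' G : E → E) (xs : E) (r μ D δ η : ℝ) (x z : ℕ → E) :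
    Prop where
  one_le_r : 1 ≤ r
  μ_pos : 0 < μ
  D_nonneg : 0 ≤ D
  η_nonneg : 0 ≤ η
  hasGradientAt : ∀ x, HasGradientAt φ (φ' x) x
  strongConvexOn : StrongConvexOn univ μ φ
  gradient_eq_zero : φ' xs = 0
  smooth : ∀ x, ‖x - xs‖ ≤ 3 * D → ∀ u, ‖φ' u - φ' x‖ ≤ μ * r ^ 2 * ‖u - x‖
  oracle_error : ∀ x, ‖x - xs‖ ≤ 3 * D → ‖G x - φ' x‖ ≤ δ
  error_le : δ * (7 * D + δ / (μ * r ^ 2)) ≤ η / r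
  radius : 2 / μ * (φ (z 0) - φ xs + μ / 2 * ‖z 0 - xs‖ ^ 2 + η) ≤ D ^ 2
  init : x 0 = z 0
  z_succ : ∀ k, z (k + 1) = x k - (1 / (μ * r ^ 2)) • G (x k)
  x_succ : ∀ k, x (k + 1) = (1 + (r - 1) / (r + 1)) • z (k + 1) - ((r - 1) / (r + 1)) • z k

namespace InexactNesterov

variable {φ : E → ℝ} {φ' G : E → E} {xs : E} {r μ D δ η : ℝ} {x z : ℕ → E}

lemma hasGradientAt_zero (h : InexactNesterov φ φ' G xs r μ D δ η x z) :
    HasGradientAt φ 0 xs := by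
  simpa only [h.gradient_eq_zero] using h.hasGradientAt xs

lemma one_sub_inv_nonneg (h : InexactNesterov φ φ' G xs r μ D δ η x z) : 0 ≤ 1 - 1 / r :=
  sub_nonneg.2 (div_le_one_of_le₀ h.one_le_r (zero_le_one.trans h.one_le_r))

lemma one_sub_inv_le_one (h : InexactNesterov φ φ' G xs r μ D δ η x z) : 1 - 1 / r ≤ 1 :=
  sub_le_self _ (one_div_nonneg.2 (zero_le_one.trans h.one_le_r))

lemma nesterovEnergy_init_nonneg (h : InexactNesterov φ φ' G xs r μ D δ η x z) :
    0 ≤ φ (z 0) - φ xs + μ / 2 * ‖z 0 - xs‖ ^ 2 := by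
  have hμ := h.μ_pos
  have := sq_norm_sub_le_of_strongConvexOn h.strongConvexOn h.hasGradientAt_zero (z 0)
  have : 0 ≤ μ / 2 * ‖z 0 - xs‖ ^ 2 := by positivity
  linarith

lemma norm_sub_le_of_energy_le (h : InexactNesterov φ φ' G xs r μ D δ η x z) {k : ℕ}
    (hk : nesterovEnergy φ xs μ r (x k) (z k)
      ≤ (1 - 1 / r) ^ k * (φ (z 0) - φ xs + μ / 2 * ‖z 0 - xs‖ ^ 2) + η) :
    ‖z k - xs‖ ≤ D :=
  norm_sub_le_of_nesterovEnergy_le h.μ_pos h.D_nonneg h.strongConvexOn h.hasGradientAt_zero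
    h.radius <| hk.trans <| add_le_add_left (mul_le_of_le_one_left h.nesterovEnergy_init_nonneg
      (pow_le_one₀ h.one_sub_inv_nonneg h.one_sub_inv_le_one)) η

lemma oracle_error_inner_le (h : InexactNesterov φ φ' G xs r μ D δ η x z) {k : ℕ}
    (hx : ‖x k - xs‖ ≤ 3 * D) (hz : ‖z k - xs‖ ≤ D) :
    inner ℝ (G (x k) - φ' (x k)) ((1 - 1 / r) • (z k - xs) - (z (k + 1) - xs)) ≤ η / r := by
  have hr := h.one_le_r
  have hμ := h.μ_pos
  have herr := h.oracle_error _ hx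
  have hstep := norm_gradient_step_sub_le (by positivity) (h.smooth _ hx) h.gradient_eq_zero hx
    herr (h.z_succ k)
  refine (inner_smul_sub_le h.one_sub_inv_nonneg h.one_sub_inv_le_one herr hz hstep).trans
    (le_of_eq_of_le ?_ h.error_le)
  ring

lemma energy_le_and_norm_sub_le (h : InexactNesterov φ φ' G xs r μ D δ η x z) (k : ℕ) :
    nesterovEnergy φ xs μ r (x k) (z k)
        ≤ (1 - 1 / r) ^ k * (φ (z 0) - φ xs + μ / 2 * ‖z 0 - xs‖ ^ 2) + η
      ∧ ‖x k - xs‖ ≤ 3 * D := by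
  induction k with
  | zero =>
    have henergy : nesterovEnergy φ xs μ r (x 0) (z 0)
        ≤ (1 - 1 / r) ^ 0 * (φ (z 0) - φ xs + μ / 2 * ‖z 0 - xs‖ ^ 2) + η := by
      rw [h.init, nesterovEnergy_self, pow_zero, one_mul]
      exact le_add_of_nonneg_right h.η_nonneg
    refine ⟨henergy, ?_⟩
    rw [h.init]
    linarith [h.norm_sub_le_of_energy_le henergy, h.D_nonneg]
  | succ k ih =>
    obtain ⟨henergy, hx⟩ := ih
    have hz := h.norm_sub_le_of_energy_le henergy
    have hstep := nesterovEnergy_step_le (xs := xs) h.one_le_r h.μ_pos h.strongConvexOn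
      h.hasGradientAt (h.smooth _ hx) (h.z_succ k) (h.x_succ k)
    have henergy' : nesterovEnergy φ xs μ r (x (k + 1)) (z (k + 1))
        ≤ (1 - 1 / r) ^ (k + 1) * (φ (z 0) - φ xs + μ / 2 * ‖z 0 - xs‖ ^ 2) + η := by
      refine (hstep.trans (add_le_add (mul_le_mul_of_nonneg_left henergy h.one_sub_inv_nonneg)
        (h.oracle_error_inner_le hx hz))).trans_eq ?_
      ring
    exact ⟨henergy', norm_momentum_sub_le h.one_le_r hz (h.norm_sub_le_of_energy_le henergy')
      (h.x_succ k)⟩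

theorem sub_le (h : InexactNesterov φ φ' G xs r μ D δ η x z) (k : ℕ) :
    φ (z k) - φ xs ≤ (1 - 1 / r) ^ k * (φ (z 0) - φ xs + μ / 2 * ‖z 0 - xs‖ ^ 2) + η :=
  (sub_le_nesterovEnergy φ xs h.μ_pos.le r (x k) (z k)).trans (h.energy_le_and_norm_sub_le k).1

end InexactNesterov

end AcceleratedGradient

lemma pow_le_exp_neg_mul {ρ a : ℝ} (hρ : 0 ≤ ρ) (hρa : ρ ≤ 1 - a) (n : ℕ) :
    ρ ^ n ≤ Real.exp (-(n * a)) := by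
  refine (pow_le_pow_left₀ hρ (hρa.trans (Real.one_sub_le_exp_neg a)) n).trans_eq ?_
  rw [← Real.exp_nat_mul, mul_neg]

section HeavyBall

variable {E : Type*} [NormedAddCommGroup E] [InnerProductSpace ℝ E]

lemma inner_map_le_of_abs_inner_map_self_le {T : E →ₗ[ℝ] E} (hT : T.IsSymmetric) {c : ℝ}
    (hc : ∀ x, |inner ℝ (T x) x| ≤ c * ‖x‖ ^ 2) (x y : E) :
    inner ℝ (T x) y ≤ c * (‖x‖ * ‖y‖) := by
  rcases eq_or_ne x 0 with rfl | hx
  · simp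
  rcases eq_or_ne y 0 with rfl | hy
  · simp
  have hadd := (abs_le.1 (hc (‖y‖ • x + ‖x‖ • y))).2
  have hsub := (abs_le.1 (hc (‖y‖ • x - ‖x‖ • y))).1
  have hsymm : inner ℝ (T y) x = inner ℝ (T x) y := by rw [hT, real_inner_comm]
  rw [norm_add_sq_real] at hadd
  rw [norm_sub_sq_real] at hsub
  simp only [map_add, map_sub, map_smul, inner_add_left, inner_add_right, inner_sub_left,
    inner_sub_right, real_inner_smul_left, inner_smul_right, norm_smul, norm_norm,
    hsymm] at hadd hsub
  have hscaled : (‖x‖ * ‖y‖) * inner ℝ (T x) y ≤ (‖x‖ * ‖y‖) * (c * (‖x‖ * ‖y‖)) := by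
    nlinarith
  exact le_of_mul_le_mul_left hscaled (by positivity)

section Recursion

variable {T : E →ₗ[ℝ] E} {ρ : ℝ} {e : ℕ → E}

/-- The quadratic form `‖e (t + 1)‖² - ⟪T e (t + 1), e t⟫ + ρ² ‖e t‖²` is multiplied by exactly `ρ²`
in each step. -/
lemma second_order_recursion_form_le (hT : T.IsSymmetric) (hρ : 0 ≤ ρ) (hρ_le : ρ ≤ 1)
    (hTρ : ∀ x, |inner ℝ (T x) x| ≤ 2 * ρ * ‖x‖ ^ 2) (h₀₁ : e 1 = e 0)
    (he : ∀ t, e (t + 2) = T (e (t + 1)) - ρ ^ 2 • e t) (t : ℕ) :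
    ‖e (t + 1)‖ ^ 2 - inner ℝ (T (e (t + 1))) (e t) + ρ ^ 2 * ‖e t‖ ^ 2
      ≤ (ρ ^ t * (2 * ‖e 0‖)) ^ 2 := by
  induction t with
  | zero =>
    have hT₀ := (abs_le.1 (hTρ (e 0))).1
    have hρ_sq : ρ ^ 2 ≤ 1 := pow_le_one₀ hρ hρ_le
    simp only [zero_add, h₀₁, pow_zero, one_mul]
    nlinarith [sq_nonneg ‖e 0‖]
  | succ t ih =>
    have hnorm : ‖e (t + 2)‖ ^ 2
        = inner ℝ (e (t + 2)) (T (e (t + 1))) - ρ ^ 2 * inner ℝ (e (t + 2)) (e t) := by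
      nth_rw 1 [← real_inner_self_eq_norm_sq]
      nth_rw 2 [he]
      rw [inner_sub_right, inner_smul_right]
    have hinner : inner ℝ (e (t + 2)) (e t)
        = inner ℝ (T (e (t + 1))) (e t) - ρ ^ 2 * ‖e t‖ ^ 2 := by
      rw [he, inner_sub_left, real_inner_smul_left, real_inner_self_eq_norm_sq]
    calc _ = ρ ^ 2 * (‖e (t + 1)‖ ^ 2 - inner ℝ (T (e (t + 1))) (e t) + ρ ^ 2 * ‖e t‖ ^ 2) := by
          rw [show t + 1 + 1 = t + 2 from rfl, hnorm, hT (e (t + 2)), hinner]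
          ring
      _ ≤ ρ ^ 2 * (ρ ^ t * (2 * ‖e 0‖)) ^ 2 := mul_le_mul_of_nonneg_left ih (sq_nonneg ρ)
      _ = (ρ ^ (t + 1) * (2 * ‖e 0‖)) ^ 2 := by ring

lemma norm_succ_le_of_second_order_recursion (hT : T.IsSymmetric) (hρ : 0 ≤ ρ) (hρ_le : ρ ≤ 1)
    (hTρ : ∀ x, |inner ℝ (T x) x| ≤ 2 * ρ * ‖x‖ ^ 2) (h₀₁ : e 1 = e 0)
    (he : ∀ t, e (t + 2) = T (e (t + 1)) - ρ ^ 2 • e t) (t : ℕ) :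
    ‖e (t + 1)‖ ≤ ρ * ‖e t‖ + ρ ^ t * (2 * ‖e 0‖) := by
  have hform := second_order_recursion_form_le hT hρ hρ_le hTρ h₀₁ he t
  have hcross := inner_map_le_of_abs_inner_map_self_le hT hTρ (e (t + 1)) (e t)
  have hsq : (‖e (t + 1)‖ - ρ * ‖e t‖) ^ 2 ≤ (ρ ^ t * (2 * ‖e 0‖)) ^ 2 := by nlinarith
  linarith [(abs_le_of_sq_le_sq' hsq (by positivity)).2]

theorem norm_le_of_second_order_recursion (hT : T.IsSymmetric) (hρ : 0 ≤ ρ) (hρ_le : ρ ≤ 1)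
    (hTρ : ∀ x, |inner ℝ (T x) x| ≤ 2 * ρ * ‖x‖ ^ 2) (h₀₁ : e 1 = e 0)
    (he : ∀ t, e (t + 2) = T (e (t + 1)) - ρ ^ 2 • e t) (t : ℕ) :
    ‖e (t + 1)‖ ≤ (2 * t + 3) * ρ ^ t * ‖e 0‖ := by
  induction t with
  | zero =>
    simp only [zero_add, h₀₁, pow_zero, Nat.cast_zero]
    linarith [norm_nonneg (e 0)]
  | succ t ih =>
    calc ‖e (t + 1 + 1)‖ ≤ ρ * ‖e (t + 1)‖ + ρ ^ (t + 1) * (2 * ‖e 0‖) :=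
          norm_succ_le_of_second_order_recursion hT hρ hρ_le hTρ h₀₁ he (t + 1)
      _ ≤ ρ * ((2 * t + 3) * ρ ^ t * ‖e 0‖) + ρ ^ (t + 1) * (2 * ‖e 0‖) := by gcongr
      _ = (2 * (t + 1 : ℕ) + 3) * ρ ^ (t + 1) * ‖e 0‖ := by push_cast; ring

end Recursion

/-- The step sizes are chosen so that `1 + θ - λ s` ranges over `[-2 √θ, 2 √θ]` for
`s ∈ [μ, L]`. -/
lemma exists_hbTheta_eq_sq {L μ : ℝ} (hμ : 0 < μ) (hL : μ ≤ L) :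
    ∃ ρ : ℝ, 0 ≤ ρ ∧ ρ ≤ 1 - 1 / √(L / μ) ∧ hbTheta L μ = ρ ^ 2 ∧
      1 + ρ ^ 2 - hbLam L μ * μ = 2 * ρ ∧ 1 + ρ ^ 2 - hbLam L μ * L = -(2 * ρ) := by
  obtain ⟨b, hb, rfl⟩ : ∃ b : ℝ, 0 < b ∧ b ^ 2 = μ := ⟨√μ, Real.sqrt_pos.2 hμ, Real.sq_sqrt hμ.le⟩
  obtain ⟨a, ha, rfl⟩ : ∃ a : ℝ, 0 < a ∧ a ^ 2 = L :=
    ⟨√L, Real.sqrt_pos.2 (hμ.trans_le hL), Real.sq_sqrt (hμ.trans_le hL).le⟩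
  have hba : b ≤ a := le_of_sq_le_sq hL ha.le
  have hlam : hbLam (a ^ 2) (b ^ 2) = (2 / (a + b)) ^ 2 := by
    rw [hbLam, Real.sqrt_sq ha.le, Real.sqrt_sq hb.le, div_pow]
    norm_num
  have hsqrt {s : ℝ} (hs : 0 ≤ s) : √(hbLam (a ^ 2) (b ^ 2) * s ^ 2) = 2 / (a + b) * s := by
    rw [hlam, ← mul_pow, Real.sqrt_sq (by positivity)]
  refine ⟨(a - b) / (a + b), div_nonneg (by linarith) (by linarith), ?_, ?_, ?_, ?_⟩
  · rw [← div_pow, Real.sqrt_sq (by positivity), one_div_div, one_sub_div ha.ne']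
    exact div_le_div_of_nonneg_left (by linarith) ha (by linarith)
  · have hb_eq : 1 - 2 / (a + b) * b = (a - b) / (a + b) := by field_simp; ring
    have ha_eq : 1 - 2 / (a + b) * a = -((a - b) / (a + b)) := by field_simp; ring
    rw [hbTheta, hsqrt hb.le, hsqrt ha.le, hb_eq, ha_eq, neg_sq, max_self]
  · rw [hlam]; field_simp; ring
  · rw [hlam]; field_simp; ring

/-- Half of the exponential decay of `ρ ^ t` absorbs the linear factor. -/
lemma linear_mul_pow_le_exp {r ρ : ℝ} (hr : 1 ≤ r) (hρ : 0 ≤ ρ) (hρr : ρ ≤ 1 - 1 / r) (t : ℕ) :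
    (2 * t + 3) * ρ ^ t ≤ 18 * r * Real.exp (-((t + 1 : ℕ) / (2 * r))) := by
  have hr₀ : 0 < r := by linarith
  have hlinear : 2 * (t : ℝ) + 3 ≤ 6 * r * Real.exp ((t + 1) / (2 * r)) := by
    have hexp : ((t : ℝ) + 1) / (2 * r) ≤ Real.exp ((t + 1) / (2 * r)) := by
      linarith [Real.add_one_le_exp (((t : ℝ) + 1) / (2 * r))]
    rw [div_le_iff₀ (by positivity)] at hexp
    linarith [t.cast_nonneg (α := ℝ)]
  have hexp_inv : Real.exp (1 / r) ≤ 3 := by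
    have := Real.exp_le_exp.2 (div_le_one_of_le₀ hr hr₀.le)
    linarith [Real.exp_one_lt_d9]
  calc (2 * t + 3) * ρ ^ t
      ≤ 6 * r * Real.exp ((t + 1) / (2 * r)) * Real.exp (-(t * (1 / r))) :=
        mul_le_mul hlinear (pow_le_exp_neg_mul hρ hρr t) (by positivity) (by positivity)
    _ = 6 * r * (Real.exp (1 / r) * Real.exp (-((t + 1 : ℕ) / (2 * r)))) := by
        rw [mul_assoc (6 * r), ← Real.exp_add, ← Real.exp_add]
        congr 2
        push_cast
        field_simp
        ring
    _ ≤ 6 * r * (3 * Real.exp (-((t + 1 : ℕ) / (2 * r)))) := by gcongr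
    _ = 18 * r * Real.exp (-((t + 1 : ℕ) / (2 * r))) := by ring

lemma heavyBall_vPrev_succ {q : ℕ} (H : Euc q →L[ℝ] Euc q) (b : Euc q) (lam θ : ℝ) (t : ℕ) :
    (heavyBall H b lam θ (t + 1)).vPrev = (heavyBall H b lam θ t).v := by
  cases t <;> rfl

lemma heavyBall_nH_succ {q : ℕ} (H : Euc q →L[ℝ] Euc q) (b : Euc q) (lam θ : ℝ) (t : ℕ) :
    (heavyBall H b lam θ (t + 1)).nH = t := by
  induction t with
  | zero => rfl
  | succ t ih => rw [heavyBall, ih]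

lemma heavyBall_sub_eq {q : ℕ} {H : Euc q →L[ℝ] Euc q} {b v : Euc q} (hv : H v = b)
    (lam θ : ℝ) (t : ℕ) :
    (heavyBall H b lam θ (t + 2)).v - v
      = ((1 + θ) • LinearMap.id - lam • (H : Euc q →ₗ[ℝ] Euc q) : Euc q →ₗ[ℝ] Euc q)
          ((heavyBall H b lam θ (t + 1)).v - v) - θ • ((heavyBall H b lam θ t).v - v) := by
  simp only [heavyBall, heavyBall_vPrev_succ, LinearMap.sub_apply, LinearMap.smul_apply,
    LinearMap.id_apply, ContinuousLinearMap.coe_coe, map_sub, hv]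
  module

theorem norm_heavyBall_sub_le {q : ℕ} {H : Euc q →L[ℝ] Euc q} {L μ : ℝ} (hμ : 0 < μ) (hL : μ ≤ L)
    (hH : (H : Euc q →ₗ[ℝ] Euc q).IsSymmetric)
    (hHμ : ∀ x, μ * ‖x‖ ^ 2 ≤ inner ℝ (H x) x) (hHL : ∀ x, inner ℝ (H x) x ≤ L * ‖x‖ ^ 2)
    {b v : Euc q} (hv : H v = b) (M : ℕ) :
    ‖(heavyBall H b (hbLam L μ) (hbTheta L μ) M).v - v‖
      ≤ 18 * √(L / μ) * Real.exp (-(M / (2 * √(L / μ)))) * ‖v‖ := by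
  obtain ⟨ρ, hρ, hρr, hθ, hρμ, hρL⟩ := exists_hbTheta_eq_sq hμ hL
  have hr : 1 ≤ √(L / μ) := by rwa [Real.one_le_sqrt, one_le_div hμ]
  have hlam : 0 ≤ hbLam L μ := div_nonneg (by norm_num) (sq_nonneg _)
  rw [hθ]
  set T : Euc q →ₗ[ℝ] Euc q := (1 + ρ ^ 2) • LinearMap.id - hbLam L μ • (H : Euc q →ₗ[ℝ] Euc q)
  have hT : T.IsSymmetric :=
    (LinearMap.IsSymmetric.id.smul (conj_trivial _)).sub (hH.smul (conj_trivial _))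
  have hTρ (x : Euc q) : |inner ℝ (T x) x| ≤ 2 * ρ * ‖x‖ ^ 2 := by
    have hquad : inner ℝ (T x) x = (1 + ρ ^ 2) * ‖x‖ ^ 2 - hbLam L μ * inner ℝ (H x) x := by
      simp [T, inner_sub_left, inner_smul_left]
    rw [hquad, abs_le, show 2 * ρ * ‖x‖ ^ 2 = (1 + ρ ^ 2 - hbLam L μ * μ) * ‖x‖ ^ 2 by rw [hρμ],
      neg_le_iff_add_nonneg]
    constructor <;>
      nlinarith [mul_le_mul_of_nonneg_left (hHμ x) hlam, mul_le_mul_of_nonneg_left (hHL x) hlam]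
  cases M with
  | zero =>
    simp only [heavyBall, zero_sub, norm_neg, Nat.cast_zero, zero_div, neg_zero, Real.exp_zero,
      mul_one]
    exact le_mul_of_one_le_left (norm_nonneg v) (by linarith)
  | succ t =>
    have hρ_le : ρ ≤ 1 := hρr.trans (sub_le_self _ (by positivity))
    refine (norm_le_of_second_order_recursion
      (e := fun t => (heavyBall H b (hbLam L μ) (ρ ^ 2) t).v - v) hT hρ hρ_le hTρ rfl
      (fun t => heavyBall_sub_eq hv _ _ t) t).trans ?_
    simp only [heavyBall, zero_sub, norm_neg]
    exact mul_le_mul_of_nonneg_right (linear_mul_pow_le_exp hr hρ hρr t) (norm_nonneg v)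

end HeavyBall

section InnerLoop

variable {p q : ℕ}

lemma agd_nG (g : Euc p → Euc q → ℝ) (L μ : ℝ) (x : Euc p) (N : ℕ) : (agd g L μ x N).nG = N := by
  induction N with
  | zero => rfl
  | succ N ih => simp only [agd, ih]

lemma inexactNesterov_agd {g : Euc p → Euc q → ℝ} {L μ D : ℝ} (hμ : 0 < μ) (hL : μ ≤ L)
    {x : Euc p} (hgrad : ∀ y, HasGradientAt (g x) (gradY g x y) y)
    (hsc : StrongConvexOn univ μ (g x))
    (hsm : ∀ y u, ‖gradY g x y - gradY g x u‖ ≤ L * ‖y - u‖)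
    {ys : Euc q} (hys : gradY g x ys = 0) (hD : 0 ≤ D)
    (hDsq : 2 / μ * (g x 0 - g x ys + μ / 2 * ‖0 - ys‖ ^ 2) ≤ D ^ 2) :
    InexactNesterov (g x) (gradY g x) (gradY g x) ys √(L / μ) μ D 0 0
      (fun t => (agd g L μ x t).s) (fun t => (agd g L μ x t).y) := by
  have hL_eq : μ * √(L / μ) ^ 2 = L := by
    rw [Real.sq_sqrt (div_nonneg (hμ.le.trans hL) hμ.le)]
    field_simp
  exact {
    one_le_r := by rwa [Real.one_le_sqrt, one_le_div hμ]
    μ_pos := hμ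
    D_nonneg := hD
    η_nonneg := le_rfl
    hasGradientAt := hgrad
    strongConvexOn := hsc
    gradient_eq_zero := hys
    smooth := fun y _ u => by rw [hL_eq]; exact hsm u y
    oracle_error := fun y _ => by simp
    error_le := by simp
    radius := by rwa [add_zero]
    init := rfl
    z_succ := fun k => by simp only [agd, hL_eq]
    x_succ := fun k => by
      have hr : √(L / μ) + 1 ≠ 0 := by positivity
      simp only [agd]
      rw [show 2 * √(L / μ) / (√(L / μ) + 1)
        = 1 + (√(L / μ) - 1) / (√(L / μ) + 1) by field_simp; ring] }

lemma one_sub_inv_pow_le_exp_sq {r : ℝ} (hr : 1 ≤ r) (N : ℕ) :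
    (1 - 1 / r) ^ N ≤ Real.exp (-(N / (2 * r))) ^ 2 := by
  have hrate : 0 ≤ 1 - 1 / r := sub_nonneg.2 (div_le_one_of_le₀ hr (by positivity))
  refine (pow_le_exp_neg_mul hrate le_rfl N).trans_eq ?_
  rw [← Real.exp_nat_mul]
  congr 1
  push_cast
  field_simp

theorem norm_agd_sub_le {g : Euc p → Euc q → ℝ} {L μ : ℝ} (hμ : 0 < μ) (hL : μ ≤ L) {x : Euc p}
    (hgrad : ∀ y, HasGradientAt (g x) (gradY g x y) y) (hsc : StrongConvexOn univ μ (g x))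
    (hsm : ∀ y u, ‖gradY g x y - gradY g x u‖ ≤ L * ‖y - u‖)
    {ys : Euc q} (hys : gradY g x ys = 0) (N : ℕ) :
    ‖(agd g L μ x N).y - ys‖ ≤ 2 * √(L / μ) * Real.exp (-(N / (2 * √(L / μ)))) * ‖ys‖ := by
  set r := √(L / μ) with hr
  have hr_one : 1 ≤ r := by rwa [hr, Real.one_le_sqrt, one_le_div hμ]
  have hr_sq : r ^ 2 = L / μ := Real.sq_sqrt (div_nonneg (hμ.le.trans hL) hμ.le)
  have hinit : g x 0 - g x ys + μ / 2 * ‖0 - ys‖ ^ 2 ≤ L * ‖ys‖ ^ 2 := by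
    have := le_add_inner_gradient_add_sq hgrad (fun u => hsm u ys) 0
    rw [hys, inner_zero_left, zero_sub, norm_neg] at this
    rw [zero_sub, norm_neg]
    nlinarith [mul_le_mul_of_nonneg_right hL (sq_nonneg ‖ys‖)]
  have hgrad_ys : HasGradientAt (g x) 0 ys := by simpa only [hys] using hgrad ys
  have hinit_nonneg : 0 ≤ g x 0 - g x ys + μ / 2 * ‖0 - ys‖ ^ 2 := by
    have := sq_norm_sub_le_of_strongConvexOn hsc hgrad_ys 0
    have : 0 ≤ μ / 2 * ‖0 - ys‖ ^ 2 := by positivity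
    linarith
  have hconv := (inexactNesterov_agd hμ hL hgrad hsc hsm hys (D := √(2 / μ * (L * ‖ys‖ ^ 2)))
    (Real.sqrt_nonneg _) (by
      rw [Real.sq_sqrt (mul_nonneg (by positivity) (mul_nonneg (by linarith) (by positivity)))]
      gcongr)).sub_le N
  have hgap : μ / 2 * ‖(agd g L μ x N).y - ys‖ ^ 2
      ≤ Real.exp (-(N / (2 * r))) ^ 2 * (L * ‖ys‖ ^ 2) := by
    refine (sq_norm_sub_le_of_strongConvexOn hsc hgrad_ys _).trans (hconv.trans ?_)
    rw [add_zero]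
    exact mul_le_mul (one_sub_inv_pow_le_exp_sq hr_one N) hinit hinit_nonneg (by positivity)
  have hsq : ‖(agd g L μ x N).y - ys‖ ^ 2 ≤ 2 * (r * Real.exp (-(N / (2 * r))) * ‖ys‖) ^ 2 := by
    rw [mul_pow, mul_pow, hr_sq, ← mul_le_mul_iff_right₀ (half_pos hμ)]
    refine hgap.trans_eq ?_
    field_simp
  refine (abs_le_of_sq_le_sq' (hsq.trans ?_) (by positivity)).2
  rw [show 2 * r * Real.exp (-(N / (2 * r))) * ‖ys‖
    = 2 * (r * Real.exp (-(N / (2 * r))) * ‖ys‖) by ring, mul_pow 2]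
  nlinarith [sq_nonneg (r * Real.exp (-(N / (2 * r))) * ‖ys‖)]

end InnerLoop

section Calculus

lemma hasFDerivAt_comp_lipschitz_section {E F G : Type*} [NormedAddCommGroup E] [NormedSpace ℝ E]
    [NormedAddCommGroup F] [NormedSpace ℝ F] [NormedAddCommGroup G] [NormedSpace ℝ G]
    {Ψ : E × F → G} {A : E →L[ℝ] G} {s : E → F} {x : E}
    (h : HasFDerivAt Ψ (A.comp (ContinuousLinearMap.fst ℝ E F)) (x, s x)) {K : ℝ}
    (hs : ∀ x', ‖s x' - s x‖ ≤ K * ‖x' - x‖) : HasFDerivAt (fun x' => Ψ (x', s x')) A x := by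
  have hO : (fun x' => s x' - s x) =O[nhds x] fun x' => x' - x :=
    Asymptotics.IsBigO.of_bound K (Filter.Eventually.of_forall hs)
  have hcont : Filter.Tendsto s (nhds x) (nhds (s x)) :=
    tendsto_sub_nhds_zero_iff.1 (hO.trans_tendsto (tendsto_sub_nhds_zero_iff.2 Filter.tendsto_id))
  rw [hasFDerivAt_iff_isLittleO]
  exact ((hasFDerivAt_iff_isLittleO.1 h).comp_tendsto
    (Filter.tendsto_id.prodMk_nhds hcont)).trans_isBigO
      ((Asymptotics.isBigO_refl (fun x' => x' - x) _).prod_left hO)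

lemma hasFDerivAt_coprod_of_partial {E F G : Type*} [NormedAddCommGroup E] [NormedSpace ℝ E]
    [NormedAddCommGroup F] [NormedSpace ℝ F] [NormedAddCommGroup G] [NormedSpace ℝ G]
    {Ψ : E × F → G} {A : E →L[ℝ] G} {B : F →L[ℝ] G} {x : E} {y : F}
    (h : DifferentiableAt ℝ Ψ (x, y)) (hA : HasFDerivAt (fun x' => Ψ (x', y)) A x)
    (hB : HasFDerivAt (fun y' => Ψ (x, y')) B y) : HasFDerivAt Ψ (A.coprod B) (x, y) := by
  have hA' := hA.unique (h.hasFDerivAt.comp x (hasFDerivAt_prodMk_left x y))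
  have hB' := hB.unique (h.hasFDerivAt.comp y (hasFDerivAt_prodMk_right x y))
  refine h.hasFDerivAt.congr_fderiv ?_
  rw [hA', hB', ContinuousLinearMap.coprod_comp_inl_inr]

variable {E : Type*} [NormedAddCommGroup E] [InnerProductSpace ℝ E]

lemma mul_norm_le_norm_of_mul_sq_norm_le_inner {μ : ℝ} {u v : E}
    (h : μ * ‖v‖ ^ 2 ≤ inner ℝ u v) : μ * ‖v‖ ≤ ‖u‖ := by
  rcases eq_or_ne v 0 with rfl | hv
  · simp
  refine le_of_mul_le_mul_right ?_ (norm_pos_iff.2 hv)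
  linarith [real_inner_le_norm u v]

lemma isInvertible_of_forall_mul_sq_norm_le_inner [FiniteDimensional ℝ E] {μ : ℝ} (hμ : 0 < μ)
    {A : E →L[ℝ] E} (hA : ∀ v, μ * ‖v‖ ^ 2 ≤ inner ℝ (A v) v) : A.IsInvertible := by
  have hinj : Function.Injective (A : E →ₗ[ℝ] E) := by
    refine (injective_iff_map_eq_zero _).2 fun v hv => norm_le_zero_iff.1 ?_
    have := mul_norm_le_norm_of_mul_sq_norm_le_inner (hA v)
    rw [ContinuousLinearMap.coe_coe] at hv
    rw [hv, norm_zero] at this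
    exact nonpos_of_mul_nonpos_right this hμ
  exact ⟨(LinearEquiv.ofInjectiveEndo _ hinj).toContinuousLinearEquiv, by ext; rfl⟩

lemma isSymmetric_of_hasGradientAt [CompleteSpace E] {φ : E → ℝ} {φ' : E → E}
    (hφ : ∀ x, HasGradientAt φ (φ' x) x) {A : E →L[ℝ] E} {x : E} (hA : HasFDerivAt φ' A x) :
    (A : E →ₗ[ℝ] E).IsSymmetric := by
  intro v w
  have hsymm : inner ℝ (A v) w = inner ℝ (A w) v :=
    second_derivative_symmetric (fun y => (hφ y).hasFDerivAt)
      ((innerSL ℝ : E →L[ℝ] StrongDual ℝ E).hasFDerivAt.comp x hA) v w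
  rw [ContinuousLinearMap.coe_coe, hsymm, real_inner_comm]

lemma mul_sq_norm_le_inner_of_hasFDerivAt {F : E → E} {A : E →L[ℝ] E} {x : E} {μ : ℝ}
    (hF : ∀ u v, μ * ‖u - v‖ ^ 2 ≤ inner ℝ (F u - F v) (u - v)) (hA : HasFDerivAt F A x) (v : E) :
    μ * ‖v‖ ^ 2 ≤ inner ℝ (A v) v := by
  have hderiv : HasDerivAt (fun t : ℝ => inner ℝ (F (x + t • v)) v) (inner ℝ (A v) v) 0 := by
    have hline : HasDerivAt (fun t : ℝ => x + t • v) v 0 := by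
      simpa using ((hasDerivAt_id (0 : ℝ)).smul_const v).const_add x
    have hcomp := (show HasFDerivAt F A (x + (0 : ℝ) • v) by simpa using hA).comp_hasDerivAt 0 hline
    simpa using hcomp.inner ℝ (hasDerivAt_const (0 : ℝ) v)
  refine ge_of_tendsto (hasDerivAt_iff_tendsto_slope.1 hderiv) ?_
  filter_upwards [self_mem_nhdsWithin] with t ht
  have ht_sq : 0 < t ^ 2 := sq_pos_of_ne_zero ht
  have hmono := hF (x + t • v) x
  rw [add_sub_cancel_left, norm_smul, mul_pow, Real.norm_eq_abs, sq_abs, inner_smul_right] at hmono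
  rw [slope_def_field, zero_smul, add_zero, ← inner_sub_left, sub_zero]
  refine le_of_mul_le_mul_left ?_ ht_sq
  calc t ^ 2 * (μ * ‖v‖ ^ 2) = μ * (t ^ 2 * ‖v‖ ^ 2) := by ring
    _ ≤ t * inner ℝ (F (x + t • v) - F x) v := hmono
    _ = t ^ 2 * (inner ℝ (F (x + t • v) - F x) v / t) := by
      have : t ≠ 0 := ht
      field_simp

lemma norm_apply_sub_apply_le {E F : Type*} [NormedAddCommGroup E] [NormedSpace ℝ E]
    [NormedAddCommGroup F] [NormedSpace ℝ F] (A A' : E →L[ℝ] F) (v v' : E) :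
    ‖A' v' - A v‖ ≤ ‖A'‖ * ‖v' - v‖ + ‖A' - A‖ * ‖v‖ := by
  have hsplit : A' v' - A v = A' (v' - v) + (A' - A) v := by
    rw [map_sub, sub_apply]
    abel
  rw [hsplit]
  exact norm_add_le_of_le (A'.le_opNorm _) ((A' - A).le_opNorm _)

lemma norm_sub_le_of_partial {E F G : Type*} [SeminormedAddCommGroup E] [SeminormedAddCommGroup F]
    [SeminormedAddCommGroup G] {Ψ : E → F → G} {a b : ℝ}
    (ha : ∀ x x' y, ‖Ψ x y - Ψ x' y‖ ≤ a * ‖x - x'‖)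
    (hb : ∀ x y y', ‖Ψ x y - Ψ x y'‖ ≤ b * ‖y - y'‖) (x x' : E) (y y' : F) :
    ‖Ψ x y - Ψ x' y'‖ ≤ a * ‖x - x'‖ + b * ‖y - y'‖ := by
  rw [← sub_add_sub_cancel _ (Ψ x' y)]
  exact norm_add_le_of_le (ha x x' y) (hb x' y y')

end Calculus

section Bilevel

variable {p q : ℕ} {f g : Euc p → Euc q → ℝ} {Lx Lxy Ly Ltxy Lty ρxy ρyy μ : ℝ}

/-- The solution `(∇²_y g)⁻¹ ∇_y f` at `(x, y)` of the linear system which the heavy-ball iteration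
approximates. -/
noncomputable def linearSol (f g : Euc p → Euc q → ℝ) (x : Euc p) (y : Euc q) : Euc q :=
  (hessYY g x y).inverse (gradY f x y)

/-- The estimate of the gradient of `Φ` at `x` built from approximations `y` of `y*(x)` and `v` of
the solution of the linear system. -/
noncomputable def hyperGradEstimate (f g : Euc p → Euc q → ℝ) (x : Euc p) (y v : Euc q) : Euc p :=
  gradX f x y - jacXY g x y v

/-- The hypergradient `∇ₓ f - ∇ₓ∇_y g (∇²_y g)⁻¹ ∇_y f` at `(x, y*(x))`. -/
noncomputable def hyperGrad (f g : Euc p → Euc q → ℝ) (x : Euc p) : Euc p :=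
  hyperGradEstimate f g x (innerSol g x) (linearSol f g x (innerSol g x))

/-- The operator `∇ₓ∇_y g (∇²_y g)⁻¹` has this Lipschitz constant in `(x, y)`. -/
noncomputable def curvature (Ltxy ρxy ρyy μ : ℝ) : ℝ := Ltxy * ρyy / μ ^ 2 + ρxy / μ

/-- A bilevel problem of the convex–strongly-convex class whose parameters satisfy the sign
conditions of the theorem. The field `μ_le_Lty` is automatic unless `q = 0`. -/
structure BilevelProblem (f g : Euc p → Euc q → ℝ) (Lx Lxy Ly Ltxy Lty ρxy ρyy μ : ℝ) : Prop
    extends IsConvexStronglyConvex f g Lx Lxy Ly Ltxy Lty ρxy ρyy μ where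
  Lx_nonneg : 0 ≤ Lx
  Lxy_nonneg : 0 ≤ Lxy
  Ly_nonneg : 0 ≤ Ly
  Ltxy_nonneg : 0 ≤ Ltxy
  ρxy_nonneg : 0 ≤ ρxy
  ρyy_nonneg : 0 ≤ ρyy
  μ_pos : 0 < μ
  μ_le_Lty : μ ≤ Lty

lemma IsConvexStronglyConvex.hasGradientAt_right
    (h : IsConvexStronglyConvex f g Lx Lxy Ly Ltxy Lty ρxy ρyy μ) (x : Euc p) (y : Euc q) :
    HasGradientAt (g x) (gradY g x y) y := by
  have hdiff : DifferentiableAt ℝ (fun y' => g x y') y :=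
    (h.contDiff_g.differentiable one_ne_zero (x, y)).comp y (f := fun y' => (x, y')) (by fun_prop)
  exact hdiff.hasGradientAt

lemma IsConvexStronglyConvex.mul_sq_norm_sub_le_inner_gradY
    (h : IsConvexStronglyConvex f g Lx Lxy Ly Ltxy Lty ρxy ρyy μ) (x : Euc p) (y y' : Euc q) :
    μ * ‖y - y'‖ ^ 2 ≤ inner ℝ (gradY g x y - gradY g x y') (y - y') :=
  mul_sq_norm_sub_le_inner_of_strongConvexOn (h.strongConvex_g x) (h.hasGradientAt_right x) y y'

lemma IsConvexStronglyConvex.μ_le_Lty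
    (h : IsConvexStronglyConvex f g Lx Lxy Ly Ltxy Lty ρxy ρyy μ) (hq : 0 < q) : μ ≤ Lty := by
  have : Nonempty (Fin q) := ⟨⟨0, hq⟩⟩
  obtain ⟨v, hv⟩ := exists_ne (0 : Euc q)
  have hmono := mul_norm_le_norm_of_mul_sq_norm_le_inner
    (h.mul_sq_norm_sub_le_inner_gradY 0 v 0)
  refine le_of_mul_le_mul_right (hmono.trans (h.gradY_g_y 0 v 0)) ?_
  rwa [sub_zero, norm_pos_iff]

namespace BilevelProblem

variable (h : BilevelProblem f g Lx Lxy Ly Ltxy Lty ρxy ρyy μ)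

include h

lemma curvature_nonneg : 0 ≤ curvature Ltxy ρxy ρyy μ := by
  have := h.Ltxy_nonneg
  have := h.ρxy_nonneg
  have := h.ρyy_nonneg
  have := h.μ_pos
  unfold curvature
  positivity

lemma gradY_innerSol (x : Euc p) : gradY g x (innerSol g x) = 0 :=
  gradient_eq_zero_of_forall_le (argminPt_le (exists_forall_le_of_strongConvexOn h.μ_pos
    (h.strongConvex_g x) fun y => (h.hasGradientAt_right x y).differentiableAt))

lemma norm_innerSol_sub_le (x x' : Euc p) :
    ‖innerSol g x - innerSol g x'‖ ≤ Ltxy / μ * ‖x - x'‖ := by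
  have hmono := mul_norm_le_norm_of_mul_sq_norm_le_inner
    (h.mul_sq_norm_sub_le_inner_gradY x' (innerSol g x) (innerSol g x'))
  have hlip := h.gradY_g_x x' x (innerSol g x)
  rw [h.gradY_innerSol, sub_zero] at hmono hlip
  rw [div_mul_eq_mul_div, le_div_iff₀ h.μ_pos, mul_comm, norm_sub_rev x]
  exact hmono.trans hlip

lemma hasFDerivAt_gradY (x : Euc p) (y : Euc q) :
    HasFDerivAt (fun y' => gradY g x y') (hessYY g x y) y := by
  have hdiff : DifferentiableAt ℝ (fun y' => gradY g x y') y :=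
    (h.differentiable_gradY_g (x, y)).comp y (f := fun y' => (x, y')) (by fun_prop)
  exact hdiff.hasFDerivAt

lemma isSymmetric_hessYY (x : Euc p) (y : Euc q) :
    (hessYY g x y : Euc q →ₗ[ℝ] Euc q).IsSymmetric :=
  isSymmetric_of_hasGradientAt (h.hasGradientAt_right x) (h.hasFDerivAt_gradY x y)

lemma mul_sq_norm_le_inner_hessYY (x : Euc p) (y v : Euc q) :
    μ * ‖v‖ ^ 2 ≤ inner ℝ (hessYY g x y v) v :=
  mul_sq_norm_le_inner_of_hasFDerivAt (h.mul_sq_norm_sub_le_inner_gradY x)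
    (h.hasFDerivAt_gradY x y) v

lemma inner_hessYY_le (x : Euc p) (y v : Euc q) :
    inner ℝ (hessYY g x y v) v ≤ Lty * ‖v‖ ^ 2 := by
  have hnorm : ‖hessYY g x y‖ ≤ Lty :=
    norm_fderiv_le_of_lip' ℝ (h.μ_pos.le.trans h.μ_le_Lty)
      (Filter.Eventually.of_forall fun y' => h.gradY_g_y x y' y)
  calc inner ℝ (hessYY g x y v) v ≤ ‖hessYY g x y v‖ * ‖v‖ := real_inner_le_norm _ _
    _ ≤ Lty * ‖v‖ * ‖v‖ := by gcongr; exact (hessYY g x y).le_of_opNorm_le hnorm v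
    _ = Lty * ‖v‖ ^ 2 := by ring

lemma norm_jacXY_le (x : Euc p) (y : Euc q) : ‖jacXY g x y‖ ≤ Ltxy := by
  rw [jacXY, LinearIsometryEquiv.norm_map]
  exact norm_fderiv_le_of_lip' ℝ h.Ltxy_nonneg
    (Filter.Eventually.of_forall fun x' => h.gradY_g_x x' x y)

lemma hessYY_linearSol (x : Euc p) (y : Euc q) :
    hessYY g x y (linearSol f g x y) = gradY f x y :=
  (isInvertible_of_forall_mul_sq_norm_le_inner h.μ_pos
    (h.mul_sq_norm_le_inner_hessYY x y)).self_apply_inverse _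

lemma norm_le_norm_hessYY_div (x : Euc p) (y v : Euc q) : ‖v‖ ≤ ‖hessYY g x y v‖ / μ := by
  rw [le_div_iff₀ h.μ_pos, mul_comm]
  exact mul_norm_le_norm_of_mul_sq_norm_le_inner (h.mul_sq_norm_le_inner_hessYY x y v)

lemma norm_linearSol_le (x : Euc p) (y : Euc q) : ‖linearSol f g x y‖ ≤ ‖gradY f x y‖ / μ := by
  simpa only [h.hessYY_linearSol] using h.norm_le_norm_hessYY_div x y (linearSol f g x y)

lemma norm_hessYY_sub_le (x x' : Euc p) (y y' : Euc q) :
    ‖hessYY g x y - hessYY g x' y'‖ ≤ ρyy * (‖x - x'‖ + ‖y - y'‖) :=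
  (h.hessYY_g x x' y y').trans <| mul_le_mul_of_nonneg_left
    (Real.sqrt_le_iff.2 ⟨by positivity, by nlinarith [norm_nonneg (x - x'), norm_nonneg (y - y')]⟩)
    h.ρyy_nonneg

lemma norm_jacXY_sub_le (x x' : Euc p) (y y' : Euc q) :
    ‖jacXY g x y - jacXY g x' y'‖ ≤ ρxy * (‖x - x'‖ + ‖y - y'‖) :=
  (h.jacXY_g x x' y y').trans <| mul_le_mul_of_nonneg_left
    (Real.sqrt_le_iff.2 ⟨by positivity, by nlinarith [norm_nonneg (x - x'), norm_nonneg (y - y')]⟩)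
    h.ρxy_nonneg

lemma norm_linearSol_sub_le (x x' : Euc p) (y y' : Euc q) :
    ‖linearSol f g x' y' - linearSol f g x y‖ ≤
      (‖gradY f x' y' - gradY f x y‖
        + ρyy * (‖x' - x‖ + ‖y' - y‖) * (‖gradY f x y‖ / μ)) / μ := by
  have hμ := h.μ_pos
  have hresidual : hessYY g x' y' (linearSol f g x' y' - linearSol f g x y)
      = (gradY f x' y' - gradY f x y) - (hessYY g x' y' - hessYY g x y) (linearSol f g x y) := by
    rw [map_sub, h.hessYY_linearSol, sub_apply, h.hessYY_linearSol]
    abel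
  refine (h.norm_le_norm_hessYY_div x' y' _).trans ?_
  rw [hresidual]
  gcongr
  refine norm_sub_le_of_le le_rfl ((ContinuousLinearMap.le_opNorm _ _).trans ?_)
  have := h.ρyy_nonneg
  gcongr
  · exact h.norm_hessYY_sub_le x' x y' y
  · exact h.norm_linearSol_le x y

lemma norm_hyperGradEstimate_linearSol_sub_le (x x' : Euc p) (y y' : Euc q) :
    ‖hyperGradEstimate f g x' y' (linearSol f g x' y')
        - hyperGradEstimate f g x y (linearSol f g x y)‖
      ≤ Lx * ‖x' - x‖ + Lxy * ‖y' - y‖ + Ltxy / μ * (Lxy * ‖x' - x‖ + Ly * ‖y' - y‖)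
        + curvature Ltxy ρxy ρyy μ * ‖gradY f x y‖ * (‖x' - x‖ + ‖y' - y‖) := by
  have hμ := h.μ_pos
  have hLtxy := h.Ltxy_nonneg
  have hρxy := h.ρxy_nonneg
  have hgradX := norm_sub_le_of_partial h.gradX_f_x h.gradX_f_y x' x y' y
  have hgradY := norm_sub_le_of_partial h.gradY_f_x h.gradY_f_y x' x y' y
  have hprod : ‖jacXY g x' y' (linearSol f g x' y') - jacXY g x y (linearSol f g x y)‖ ≤
      Ltxy * ((Lxy * ‖x' - x‖ + Ly * ‖y' - y‖
          + ρyy * (‖x' - x‖ + ‖y' - y‖) * (‖gradY f x y‖ / μ)) / μ)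
        + ρxy * (‖x' - x‖ + ‖y' - y‖) * (‖gradY f x y‖ / μ) := by
    refine (norm_apply_sub_apply_le _ _ _ _).trans ?_
    gcongr
    · exact h.norm_jacXY_le x' y'
    · refine (h.norm_linearSol_sub_le x x' y y').trans ?_
      gcongr
    · exact h.norm_jacXY_sub_le x' x y' y
    · exact h.norm_linearSol_le x y
  rw [hyperGradEstimate, hyperGradEstimate, sub_sub_sub_comm]
  refine (norm_sub_le_of_le hgradX hprod).trans_eq ?_
  rw [curvature]
  field_simp
  ring

lemma hasFDerivAt_uncurry_left (x : Euc p) (y : Euc q) :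
    HasFDerivAt (fun z : Euc p × Euc q => f z.1 z.2)
      ((innerSL ℝ (gradX f x y)).coprod (innerSL ℝ (gradY f x y))) (x, y) := by
  have hdiff := h.contDiff_f.differentiable one_ne_zero (x, y)
  exact hasFDerivAt_coprod_of_partial hdiff
    (hdiff.comp x (f := fun x' => (x', y)) (by fun_prop)).hasGradientAt.hasFDerivAt
    (hdiff.comp y (f := fun y' => (x, y')) (by fun_prop)).hasGradientAt.hasFDerivAt

lemma hasFDerivAt_uncurry_gradY (x : Euc p) (y : Euc q) :
    HasFDerivAt (fun z : Euc p × Euc q => gradY g z.1 z.2)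
      ((ContinuousLinearMap.adjoint (jacXY g x y)).coprod (hessYY g x y)) (x, y) := by
  have hdiff := h.differentiable_gradY_g (x, y)
  have hleft : DifferentiableAt ℝ (fun x' => gradY g x' y) x :=
    hdiff.comp x (f := fun x' => (x', y)) (by fun_prop)
  rw [jacXY, ContinuousLinearMap.adjoint_adjoint]
  exact hasFDerivAt_coprod_of_partial hdiff hleft.hasFDerivAt (h.hasFDerivAt_gradY x y)

/-- Subtracting `⟪v, ∇_y g⟫`, which vanishes along `y*`, from `f` cancels the derivative in `y`, so
that differentiability of `y*` is not needed. -/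
theorem hasGradientAt_totalObj (x : Euc p) :
    HasGradientAt (totalObj f g) (hyperGrad f g x) x := by
  set y := innerSol g x with hy
  set v := linearSol f g x y with hv
  have hlagrangian := (h.hasFDerivAt_uncurry_left x y).sub
    ((innerSL ℝ v).hasFDerivAt.comp (x, y) (h.hasFDerivAt_uncurry_gradY x y))
  have hcancel (u : Euc q) : inner ℝ (gradY f x y) u = inner ℝ v (hessYY g x y u) := by
    rw [← h.hessYY_linearSol x y]
    exact h.isSymmetric_hessYY x y v u
  have hsection := hasFDerivAt_comp_lipschitz_section (s := innerSol g) (x := x)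
    (A := innerSL ℝ (hyperGrad f g x)) (hlagrangian.congr_fderiv ?_)
    (fun x' => h.norm_innerSol_sub_le x' x)
  · rw [hasGradientAt_iff_hasFDerivAt]
    refine hsection.congr_of_eventuallyEq (Filter.Eventually.of_forall fun x' => ?_)
    simp [totalObj, h.gradY_innerSol x']
  · ext u
    · simp [hyperGrad, hyperGradEstimate, ContinuousLinearMap.adjoint_inner_right, ← hy, ← hv]
    · simp [hcancel]

theorem norm_hyperGrad_sub_le (x x' : Euc p) :
    ‖hyperGrad f g x' - hyperGrad f g x‖ ≤
      (Lx + 2 * Lxy * Ltxy / μ + Ly * Ltxy ^ 2 / μ ^ 2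
        + curvature Ltxy ρxy ρyy μ * (1 + Ltxy / μ) * ‖gradY f x (innerSol g x)‖)
        * ‖x' - x‖ := by
  have := h.μ_pos
  have := h.Ltxy_nonneg
  have := h.Lxy_nonneg
  have := h.Ly_nonneg
  have := h.curvature_nonneg
  have hy := h.norm_innerSol_sub_le x' x
  calc ‖hyperGrad f g x' - hyperGrad f g x‖
      ≤ _ := h.norm_hyperGradEstimate_linearSol_sub_le x x' (innerSol g x) (innerSol g x')
    _ ≤ Lx * ‖x' - x‖ + Lxy * (Ltxy / μ * ‖x' - x‖)
        + Ltxy / μ * (Lxy * ‖x' - x‖ + Ly * (Ltxy / μ * ‖x' - x‖))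
        + curvature Ltxy ρxy ρyy μ * ‖gradY f x (innerSol g x)‖
          * (‖x' - x‖ + Ltxy / μ * ‖x' - x‖) := by gcongr
    _ = _ := by ring

theorem norm_hyperGradEstimate_sub_hyperGrad_le (x : Euc p) (y v : Euc q) :
    ‖hyperGradEstimate f g x y v - hyperGrad f g x‖ ≤
      (Lxy + Ltxy * Ly / μ + curvature Ltxy ρxy ρyy μ * ‖gradY f x (innerSol g x)‖)
        * ‖y - innerSol g x‖ + Ltxy * ‖v - linearSol f g x y‖ := by
  have hy := h.norm_hyperGradEstimate_linearSol_sub_le x x (innerSol g x) y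
  have hv : ‖hyperGradEstimate f g x y v - hyperGradEstimate f g x y (linearSol f g x y)‖
      ≤ Ltxy * ‖v - linearSol f g x y‖ := by
    rw [hyperGradEstimate, hyperGradEstimate, sub_sub_sub_cancel_left, norm_sub_rev, ← map_sub]
    exact (jacXY g x y).le_of_opNorm_le (h.norm_jacXY_le x y) _
  rw [← sub_add_sub_cancel _ (hyperGradEstimate f g x y (linearSol f g x y))]
  refine (norm_add_le_of_le hv hy).trans_eq ?_
  rw [sub_self, norm_zero]
  ring

end BilevelProblem

end Bilevel

section Outer

variable {p q : ℕ} {f g : Euc p → Euc q → ℝ} {Lx Lxy Ly Ltxy Lty ρxy ρyy μ : ℝ}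

/-- Radius of a ball around the minimizer `xs` that contains the iterates `z_k` of AccBiO. It is the
square root in the smoothness parameter. -/
noncomputable def iterateRadius (f g : Euc p → Euc q → ℝ) (μx ε : ℝ) (xs : Euc p) : ℝ :=
  √(2 / μx * (totalObj f g 0 - totalObj f g xs) + ‖xs‖ ^ 2 + ε / μx)

/-- The approximate hypergradient at `x` by which AccBiO moves. -/
noncomputable def accBiOGrad (f g : Euc p → Euc q → ℝ) (Lty μ : ℝ) (M N : ℕ) (x : Euc p) : Euc p :=
  hyperGradEstimate f g x (agd g Lty μ x N).y
    (heavyBall (hessYY g x (agd g Lty μ x N).y) (gradY f x (agd g Lty μ x N).y)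
      (hbLam Lty μ) (hbTheta Lty μ) M).v

/-- The error of `accBiOGrad` per unit of relative error of the two inner methods, at a point where
`‖∇_y f‖ ≤ β` and `‖y*‖ ≤ Y`. -/
noncomputable def innerErrorConst (Lxy Ly Ltxy Lty ρxy ρyy μ β Y : ℝ) : ℝ :=
  (Lxy + Ltxy * Ly / μ + curvature Ltxy ρxy ρyy μ * β) * (2 * √(Lty / μ) * Y)
    + Ltxy * (18 * √(Lty / μ) * ((β + Ly * (2 * √(Lty / μ) * Y)) / μ))

lemma sq_iterateRadius {μx ε : ℝ} (hμx : 0 ≤ μx) (hε : 0 ≤ ε) {xs : Euc p}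
    (hxs : ∀ u, totalObj f g xs ≤ totalObj f g u) :
    iterateRadius f g μx ε xs ^ 2
      = 2 / μx * (totalObj f g 0 - totalObj f g xs) + ‖xs‖ ^ 2 + ε / μx := by
  have := sub_nonneg.2 (hxs 0)
  exact Real.sq_sqrt (by positivity)

lemma norm_sub_le_three_mul_iterateRadius {μx ε : ℝ} (hμx : 0 < μx)
    (hsc : StrongConvexOn univ μx (totalObj f g)) {xs z : Euc p}
    (hxs : ∀ u, totalObj f g xs ≤ totalObj f g u) (hgrad : HasGradientAt (totalObj f g) 0 xs)
    (hz : totalObj f g z - totalObj f g xs ≤ ε) :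
    ‖z - xs‖ ≤ 3 * iterateRadius f g μx ε xs := by
  have hε : 0 ≤ ε := (sub_nonneg.2 (hxs z)).trans hz
  have hD : 0 ≤ iterateRadius f g μx ε xs := Real.sqrt_nonneg _
  have hΦ : 0 ≤ 2 / μx * (totalObj f g 0 - totalObj f g xs) :=
    mul_nonneg (by positivity) (sub_nonneg.2 (hxs 0))
  have hdist : ‖z - xs‖ ^ 2 ≤ 2 * (ε / μx) := by
    rw [← mul_div_assoc, le_div_iff₀ hμx]
    linarith [sq_norm_sub_le_of_strongConvexOn hsc hgrad z]
  refine le_of_sq_le_sq ?_ (by positivity)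
  linarith [sq_iterateRadius hμx.le hε hxs, sq_nonneg ‖xs‖, sq_nonneg (iterateRadius f g μx ε xs)]

lemma cost_accBiO_le {τ : ℝ} (hτ : 0 ≤ τ) (f g : Euc p → Euc q → ℝ) (Lty μ L μx : ℝ) (M N K : ℕ) :
    (accBiO f g Lty μ L μx M N K).count.cost τ ≤ K * (τ * (1 + M) + (N + 2)) := by
  have hnH (H : Euc q →L[ℝ] Euc q) b lam θ : ((heavyBall H b lam θ M).nH : ℝ) ≤ M := by
    cases M with
    | zero => simp [heavyBall]
    | succ M => simp [heavyBall_nH_succ]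
  induction K with
  | zero => simp [accBiO, OracleCount.cost]
  | succ K ih =>
    rw [OracleCount.cost] at ih ⊢
    simp only [accBiO, agd_nG]
    push_cast
    set st := accBiO f g Lty μ L μx M N K
    have := mul_le_mul_of_nonneg_left (hnH (hessYY g st.x (agd g Lty μ st.x N).y)
      (gradY f st.x (agd g Lty μ st.x N).y) (hbLam Lty μ) (hbTheta Lty μ)) hτ
    linarith

namespace BilevelProblem

variable (h : BilevelProblem f g Lx Lxy Ly Ltxy Lty ρxy ρyy μ)

include h

lemma le_smoothnessParam (μx ε : ℝ) (xs : Euc p) :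
    Lx ≤ smoothnessParam f g Lx Lxy Ly Ltxy ρxy ρyy μ μx ε xs := by
  have := h.Lxy_nonneg
  have := h.Ly_nonneg
  have := h.Ltxy_nonneg
  have := h.ρxy_nonneg
  have := h.ρyy_nonneg
  have := h.μ_pos
  simp only [smoothnessParam, add_assoc]
  exact le_add_of_nonneg_right (by positivity)

lemma norm_gradY_innerSol_le (x x' : Euc p) :
    ‖gradY f x (innerSol g x)‖
      ≤ ‖gradY f x' (innerSol g x')‖ + (Lxy + Ly * Ltxy / μ) * ‖x - x'‖ := by
  have hpartial :=
    norm_sub_le_of_partial h.gradY_f_x h.gradY_f_y x x' (innerSol g x) (innerSol g x')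
  have hsol := mul_le_mul_of_nonneg_left (h.norm_innerSol_sub_le x x') h.Ly_nonneg
  have hnorm := norm_sub_norm_le (gradY f x (innerSol g x)) (gradY f x' (innerSol g x'))
  rw [← mul_assoc, ← mul_div_assoc] at hsol
  linarith

lemma norm_innerSol_le (x x' : Euc p) :
    ‖innerSol g x‖ ≤ ‖innerSol g x'‖ + Ltxy / μ * ‖x - x'‖ := by
  linarith [h.norm_innerSol_sub_le x x', norm_sub_norm_le (innerSol g x) (innerSol g x')]

lemma norm_hyperGrad_sub_le_smoothnessParam {μx ε : ℝ} {xs x : Euc p}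
    (hx : ‖x - xs‖ ≤ 3 * iterateRadius f g μx ε xs) (x' : Euc p) :
    ‖hyperGrad f g x' - hyperGrad f g x‖
      ≤ smoothnessParam f g Lx Lxy Ly Ltxy ρxy ρyy μ μx ε xs * ‖x' - x‖ := by
  have := h.Lxy_nonneg
  have := h.Ly_nonneg
  have := h.Ltxy_nonneg
  have := h.μ_pos
  have := h.curvature_nonneg
  have hgradY : ‖gradY f x (innerSol g x)‖ ≤ ‖gradY f xs (innerSol g xs)‖
      + (Lxy + Ly * Ltxy / μ) * (3 * iterateRadius f g μx ε xs) :=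
    (h.norm_gradY_innerSol_le x xs).trans (by gcongr)
  refine (h.norm_hyperGrad_sub_le x x').trans (mul_le_mul_of_nonneg_right ?_ (norm_nonneg _))
  calc _ ≤ Lx + 2 * Lxy * Ltxy / μ + Ly * Ltxy ^ 2 / μ ^ 2
        + curvature Ltxy ρxy ρyy μ * (1 + Ltxy / μ) * (‖gradY f xs (innerSol g xs)‖
          + (Lxy + Ly * Ltxy / μ) * (3 * iterateRadius f g μx ε xs)) := by gcongr
    _ = _ := by rw [smoothnessParam, iterateRadius, curvature]; ring

lemma norm_agd_sub_innerSol_le {x : Euc p} {Y : ℝ} (hY : ‖innerSol g x‖ ≤ Y) (N : ℕ) :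
    ‖(agd g Lty μ x N).y - innerSol g x‖
      ≤ 2 * √(Lty / μ) * Y * Real.exp (-(N / (2 * √(Lty / μ)))) := by
  refine (norm_agd_sub_le h.μ_pos h.μ_le_Lty (h.hasGradientAt_right x) (h.strongConvex_g x)
    (h.gradY_g_y x) (h.gradY_innerSol x) N).trans ?_
  rw [mul_right_comm]
  gcongr

lemma norm_heavyBall_sub_linearSol_le (x : Euc p) (y : Euc q) {β : ℝ} (hβ : ‖gradY f x y‖ ≤ β)
    (M : ℕ) :
    ‖(heavyBall (hessYY g x y) (gradY f x y) (hbLam Lty μ) (hbTheta Lty μ) M).v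
        - linearSol f g x y‖
      ≤ 18 * √(Lty / μ) * (β / μ) * Real.exp (-(M / (2 * √(Lty / μ)))) := by
  have hμ := h.μ_pos
  refine (norm_heavyBall_sub_le hμ h.μ_le_Lty (h.isSymmetric_hessYY x y)
    (h.mul_sq_norm_le_inner_hessYY x y) (h.inner_hessYY_le x y) (h.hessYY_linearSol x y) M).trans ?_
  rw [mul_right_comm]
  have := (h.norm_linearSol_le x y).trans (div_le_div_of_nonneg_right hβ hμ.le)
  gcongr

lemma norm_accBiOGrad_sub_hyperGrad_le {x : Euc p} {β Y ω : ℝ}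
    (hβ : ‖gradY f x (innerSol g x)‖ ≤ β) (hY : ‖innerSol g x‖ ≤ Y) {M N : ℕ}
    (hM : Real.exp (-(M / (2 * √(Lty / μ)))) ≤ ω) (hN : Real.exp (-(N / (2 * √(Lty / μ)))) ≤ ω) :
    ‖accBiOGrad f g Lty μ M N x - hyperGrad f g x‖
      ≤ innerErrorConst Lxy Ly Ltxy Lty ρxy ρyy μ β Y * ω := by
  have hμ := h.μ_pos
  have := h.Lxy_nonneg
  have hLy := h.Ly_nonneg
  have := h.Ltxy_nonneg
  have := h.curvature_nonneg
  have hβ₀ : 0 ≤ β := (norm_nonneg _).trans hβ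
  have hY₀ : 0 ≤ Y := (norm_nonneg _).trans hY
  have hy := h.norm_agd_sub_innerSol_le hY N
  have hexp : Real.exp (-(N / (2 * √(Lty / μ)))) ≤ 1 :=
    Real.exp_le_one_iff.2 (neg_nonpos.2 (by positivity))
  set y := (agd g Lty μ x N).y
  have hgradY : ‖gradY f x y‖ ≤ β + Ly * (2 * √(Lty / μ) * Y) := by
    have hlip := (h.gradY_f_y x y (innerSol g x)).trans (mul_le_mul_of_nonneg_left
      (hy.trans (mul_le_of_le_one_right (by positivity) hexp)) hLy)
    linarith [norm_sub_norm_le (gradY f x y) (gradY f x (innerSol g x))]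
  have hv := h.norm_heavyBall_sub_linearSol_le x y hgradY M
  calc ‖accBiOGrad f g Lty μ M N x - hyperGrad f g x‖
      ≤ _ := h.norm_hyperGradEstimate_sub_hyperGrad_le x y _
    _ ≤ (Lxy + Ltxy * Ly / μ + curvature Ltxy ρxy ρyy μ * β) * (2 * √(Lty / μ) * Y * ω)
        + Ltxy * (18 * √(Lty / μ) * ((β + Ly * (2 * √(Lty / μ) * Y)) / μ) * ω) := by
      refine add_le_add ?_ (mul_le_mul_of_nonneg_left (hv.trans ?_) h.Ltxy_nonneg)
      · gcongr
        exact hy.trans (by gcongr)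
      · gcongr
    _ = _ := by rw [innerErrorConst]; ring

lemma inexactNesterov_accBiO {μx ε δ L : ℝ} (hμx : 0 < μx) (hμxLx : μx ≤ Lx) (hε : 0 < ε)
    (hsc : StrongConvexOn univ μx (totalObj f g)) {xs : Euc p}
    (hxs : ∀ u, totalObj f g xs ≤ totalObj f g u)
    (hL : L = smoothnessParam f g Lx Lxy Ly Ltxy ρxy ρyy μ μx ε xs) {M N : ℕ}
    (hδ : ∀ x, ‖x - xs‖ ≤ 3 * iterateRadius f g μx ε xs →
      ‖accBiOGrad f g Lty μ M N x - hyperGrad f g x‖ ≤ δ)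
    (hδε : δ * (7 * iterateRadius f g μx ε xs + δ / L) ≤ ε / 2 / √(L / μx)) :
    InexactNesterov (totalObj f g) (hyperGrad f g) (accBiOGrad f g Lty μ M N) xs
      √(L / μx) μx (iterateRadius f g μx ε xs) δ (ε / 2)
      (fun k => (accBiO f g Lty μ L μx M N k).x) (fun k => (accBiO f g Lty μ L μx M N k).z) := by
  have hμxL : μx ≤ L := hμxLx.trans (hL ▸ h.le_smoothnessParam μx ε xs)
  have hLr : μx * √(L / μx) ^ 2 = L := by
    rw [Real.sq_sqrt (div_nonneg (hμx.le.trans hμxL) hμx.le), mul_div_cancel₀ _ hμx.ne']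
  exact {
    one_le_r := by rwa [Real.one_le_sqrt, one_le_div hμx]
    μ_pos := hμx
    D_nonneg := Real.sqrt_nonneg _
    η_nonneg := (half_pos hε).le
    hasGradientAt := h.hasGradientAt_totalObj
    strongConvexOn := hsc
    gradient_eq_zero := (h.hasGradientAt_totalObj xs).gradient ▸ gradient_eq_zero_of_forall_le hxs
    smooth := fun x hx u => by
      rw [hLr, hL]
      exact h.norm_hyperGrad_sub_le_smoothnessParam hx u
    oracle_error := hδ
    error_le := by rwa [hLr]
    radius := by
      rw [sq_iterateRadius hμx.le hε.le hxs]
      simp only [accBiO, zero_sub, norm_neg]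
      apply le_of_eq
      field_simp
    init := rfl
    z_succ := fun k => by rw [hLr]; rfl
    x_succ := fun k => rfl }

theorem accBiO_gap_le {μx ε δ L : ℝ} (hμx : 0 < μx) (hμxLx : μx ≤ Lx) (hε : 0 < ε)
    (hsc : StrongConvexOn univ μx (totalObj f g)) {xs : Euc p}
    (hxs : ∀ u, totalObj f g xs ≤ totalObj f g u)
    (hL : L = smoothnessParam f g Lx Lxy Ly Ltxy ρxy ρyy μ μx ε xs) {M N : ℕ}
    (hδ : ∀ x, ‖x - xs‖ ≤ 3 * iterateRadius f g μx ε xs →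
      ‖accBiOGrad f g Lty μ M N x - hyperGrad f g x‖ ≤ δ)
    (hδε : δ * (7 * iterateRadius f g μx ε xs + δ / L) ≤ ε / 2 / √(L / μx)) (K : ℕ) :
    totalObj f g (accBiO f g Lty μ L μx M N K).z - totalObj f g xs ≤
      (1 - 1 / √(L / μx)) ^ K * (totalObj f g 0 - totalObj f g xs + μx / 2 * ‖xs‖ ^ 2)
        + ε / 2 := by
  simpa only [accBiO, zero_sub, norm_neg]
    using (h.inexactNesterov_accBiO hμx hμxLx hε hsc hxs hL hδ hδε).sub_le K

end BilevelProblem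

end Outer

section Regularization

variable {p q : ℕ} {f g : Euc p → Euc q → ℝ} {Lx Lxy Ly Ltxy Lty ρxy ρyy μ ε R : ℝ}

/-- The minimizer `x̃*` of the regularized total objective `Φ̃`. -/
noncomputable def regMinimizer (f g : Euc p → Euc q → ℝ) (ε R : ℝ) : Euc p :=
  argminPt (totalObj (regularize f ε R) g)

lemma gradY_regularize (f : Euc p → Euc q → ℝ) (ε R : ℝ) (x : Euc p) (y : Euc q) :
    gradY (regularize f ε R) x y = gradY f x y := by
  simp only [gradY, regularize, gradient, fderiv_add_const]

lemma totalObj_regularize (f g : Euc p → Euc q → ℝ) (ε R : ℝ) (x : Euc p) :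
    totalObj (regularize f ε R) g x = totalObj f g x + ε / (2 * R) * ‖x‖ ^ 2 := rfl

lemma gradX_regularize (hf : ContDiff ℝ 1 fun z : Euc p × Euc q => f z.1 z.2) (ε R : ℝ) (x : Euc p)
    (y : Euc q) : gradX (regularize f ε R) x y = gradX f x y + (ε / R) • x := by
  have hf_x : DifferentiableAt ℝ (fun x' => f x' y) x :=
    (hf.differentiable one_ne_zero (x, y)).comp x (f := fun x' => (x', y)) (by fun_prop)
  refine HasGradientAt.gradient (hasGradientAt_iff_hasFDerivAt.2 ?_)
  refine (hf_x.hasGradientAt.hasFDerivAt.add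
    ((hasStrictFDerivAt_norm_sq x).hasFDerivAt.const_mul (ε / (2 * R)))).congr_fderiv ?_
  ext v
  simp [gradX]
  ring

namespace BilevelProblem

variable (h : BilevelProblem f g Lx Lxy Ly Ltxy Lty ρxy ρyy μ)

include h

protected lemma regularize (hε : 0 ≤ ε) (hR : 0 ≤ R) :
    BilevelProblem (regularize f ε R) g (Lx + ε / R) Lxy Ly Ltxy Lty ρxy ρyy μ where
  __ := h
  contDiff_f := h.contDiff_f.add (contDiff_const.mul (contDiff_fst.norm_sq ℝ))
  gradX_f_x x₁ x₂ y := by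
    rw [gradX_regularize h.contDiff_f, gradX_regularize h.contDiff_f, add_sub_add_comm, ← smul_sub,
      add_mul]
    refine (norm_add_le _ _).trans (add_le_add (h.gradX_f_x x₁ x₂ y) ?_)
    rw [norm_smul, Real.norm_of_nonneg (div_nonneg hε hR)]
  gradX_f_y x y₁ y₂ := by
    rw [gradX_regularize h.contDiff_f, gradX_regularize h.contDiff_f, add_sub_add_right_eq_sub]
    exact h.gradX_f_y x y₁ y₂
  gradY_f_x x₁ x₂ y := by simpa only [gradY_regularize] using h.gradY_f_x x₁ x₂ y
  gradY_f_y x y₁ y₂ := by simpa only [gradY_regularize] using h.gradY_f_y x y₁ y₂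
  convex_totalObj := by
    refine h.convex_totalObj.add (ConvexOn.smul (c := ε / (2 * R)) (by positivity) ?_)
    exact (convexOn_norm convex_univ).pow (fun _ _ => norm_nonneg _) 2
  Lx_nonneg := add_nonneg h.Lx_nonneg (div_nonneg hε hR)

lemma strongConvexOn_regularize (ε R : ℝ) :
    StrongConvexOn univ (ε / R) (totalObj (regularize f ε R) g) := by
  rw [strongConvexOn_iff_convex]
  refine h.convex_totalObj.congr fun x _ => ?_
  rw [totalObj_regularize]
  ring

lemma hyperGrad_regularize (ε R : ℝ) (x : Euc p) :
    hyperGrad (regularize f ε R) g x = hyperGrad f g x + (ε / R) • x := by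
  simp only [hyperGrad, hyperGradEstimate, gradX_regularize h.contDiff_f, linearSol,
    gradY_regularize]
  abel

lemma regMinimizer_le (hε : 0 < ε) (hR : 0 < R) (u : Euc p) :
    totalObj (regularize f ε R) g (regMinimizer f g ε R)
      ≤ totalObj (regularize f ε R) g u :=
  argminPt_le (exists_forall_le_of_strongConvexOn (div_pos hε hR)
    (h.strongConvexOn_regularize ε R) fun x =>
      ((h.regularize hε.le hR.le).hasGradientAt_totalObj x).differentiableAt) u

lemma norm_regMinimizer_le (hε : 0 < ε) (hR : 0 < R) {xs : Euc p}
    (hxs : ∀ u, totalObj f g xs ≤ totalObj f g u) : ‖regMinimizer f g ε R‖ ≤ ‖xs‖ := by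
  have hreg := h.regMinimizer_le hε hR xs
  rw [totalObj_regularize, totalObj_regularize] at hreg
  have hsq : ε / (2 * R) * ‖regMinimizer f g ε R‖ ^ 2 ≤ ε / (2 * R) * ‖xs‖ ^ 2 := by
    linarith [hxs (regMinimizer f g ε R)]
  exact le_of_sq_le_sq (le_of_mul_le_mul_left hsq (by positivity)) (norm_nonneg _)

end BilevelProblem

end Regularization

section Scale

variable {p q : ℕ} {f g : Euc p → Euc q → ℝ} {Lx Lxy Ly Ltxy Lty ρxy ρyy μ ε R ε' c L : ℝ}

/-- The part `1 / μ² + (ρyy / μ³ + ρxy / μ²) Δ` of the smoothness constant of the total objective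
that is not controlled by the Lipschitz constants of the gradients; `Δ` stands for `Δ*_CSC`. -/
noncomputable def smoothnessScale (ρxy ρyy μ Δ : ℝ) : ℝ :=
  1 / μ ^ 2 + (ρyy / μ ^ 3 + ρxy / μ ^ 2) * Δ

lemma norm_gradY_add_norm_div_le_deltaCSC (hμ : 0 ≤ μ) (f g : Euc p → Euc q → ℝ) (ε : ℝ)
    (xs : Euc p) : ‖gradY f xs (innerSol g xs)‖ + ‖xs‖ / μ ≤ deltaCSC f g μ ε xs :=
  le_add_of_nonneg_right (by positivity)

lemma deltaCSC_nonneg (hμ : 0 ≤ μ) (f g : Euc p → Euc q → ℝ) (ε : ℝ) (xs : Euc p) :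
    0 ≤ deltaCSC f g μ ε xs := by
  rw [deltaCSC]
  positivity

lemma norm_add_sqrt_gap_le (hμ : 0 < μ) (f g : Euc p → Euc q → ℝ) (ε : ℝ) (xs : Euc p) :
    ‖xs‖ + (‖xs‖ + 1) * √(totalObj f g 0 - totalObj f g xs) / √ε ≤ μ * deltaCSC f g μ ε xs := by
  rw [← div_le_iff₀' hμ, add_div, div_div, deltaCSC, add_assoc]
  exact le_add_of_nonneg_left (norm_nonneg _)

lemma norm_le_mul_deltaCSC (hμ : 0 < μ) (f g : Euc p → Euc q → ℝ) (ε : ℝ) (xs : Euc p) :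
    ‖xs‖ ≤ μ * deltaCSC f g μ ε xs :=
  (le_add_of_nonneg_right (by positivity)).trans (norm_add_sqrt_gap_le hμ f g ε xs)

lemma gap_le_mul_sq_deltaCSC (hμ : 0 < μ) (hε : 0 < ε) {xs : Euc p}
    (hxs : ∀ u, totalObj f g xs ≤ totalObj f g u) :
    totalObj f g 0 - totalObj f g xs ≤ ε * (μ * deltaCSC f g μ ε xs) ^ 2 := by
  have hgap := sub_nonneg.2 (hxs 0)
  have hsqrt : √(totalObj f g 0 - totalObj f g xs) / √ε ≤ μ * deltaCSC f g μ ε xs := by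
    refine le_trans ?_ (norm_add_sqrt_gap_le hμ f g ε xs)
    rw [mul_div_assoc, add_mul, one_mul, ← add_assoc]
    exact le_add_of_nonneg_left (by positivity)
  have hsq := pow_le_pow_left₀ (by positivity) hsqrt 2
  rwa [div_pow, Real.sq_sqrt hgap, Real.sq_sqrt hε.le, div_le_iff₀' hε] at hsq

namespace BilevelProblem

variable (h : BilevelProblem f g Lx Lxy Ly Ltxy Lty ρxy ρyy μ)
  (hc : 1 + Lx + Lxy + Ly + Ltxy + μ ≤ c)

include h hc

lemma smoothness_constant_part_le :
    Lx + 2 * Lxy * Ltxy / μ + Ly * Ltxy ^ 2 / μ ^ 2 ≤ 4 * c ^ 3 / μ ^ 2 := by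
  have hμ := h.μ_pos
  have := h.Lx_nonneg
  have := h.Lxy_nonneg
  have := h.Ly_nonneg
  have := h.Ltxy_nonneg
  have hc₀ : 0 ≤ c := by linarith
  have hLx : Lx * μ ^ 2 ≤ c * c ^ 2 := by gcongr <;> linarith
  have hLxy : Lxy * Ltxy * μ ≤ c * c * c := by gcongr <;> linarith
  have hLy : Ly * Ltxy ^ 2 ≤ c * c ^ 2 := by gcongr <;> linarith
  calc Lx + 2 * Lxy * Ltxy / μ + Ly * Ltxy ^ 2 / μ ^ 2
      = (Lx * μ ^ 2 + 2 * (Lxy * Ltxy * μ) + Ly * Ltxy ^ 2) / μ ^ 2 := by field_simp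
    _ ≤ _ := by gcongr; linarith

lemma curvature_mul_le :
    curvature Ltxy ρxy ρyy μ * (1 + Ltxy / μ) ≤ c ^ 2 * (ρyy / μ ^ 3 + ρxy / μ ^ 2) := by
  have hμ := h.μ_pos
  have := h.Lx_nonneg
  have := h.Lxy_nonneg
  have := h.Ly_nonneg
  have := h.Ltxy_nonneg
  have := h.ρxy_nonneg
  have := h.ρyy_nonneg
  have hc₀ : 0 ≤ c := by linarith
  have hratio : 1 + Ltxy / μ ≤ c / μ := by
    rw [← div_self hμ.ne', ← add_div]
    gcongr
    linarith
  calc curvature Ltxy ρxy ρyy μ * (1 + Ltxy / μ)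
      ≤ (c * ρyy / μ ^ 2 + c * ρxy / μ) * (c / μ) := by
        rw [curvature]
        gcongr
        · linarith
        · exact le_mul_of_one_le_left h.ρxy_nonneg (by linarith)
    _ = _ := by field_simp

lemma gradY_lipschitz_le : Lxy + Ly * Ltxy / μ ≤ c ^ 2 / μ := by
  have hμ := h.μ_pos
  have := h.Lx_nonneg
  have := h.Lxy_nonneg
  have := h.Ly_nonneg
  have := h.Ltxy_nonneg
  have hc₀ : 0 ≤ c := by linarith
  have hLxy : Lxy * μ ≤ Lxy * c := by gcongr; linarith
  have hLy : Ly * Ltxy ≤ Ly * c := by gcongr; linarith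
  have hsum : (Lxy + Ly) * c ≤ c * c := by gcongr; linarith
  rw [le_div_iff₀ hμ, add_mul, div_mul_cancel₀ _ hμ.ne']
  linarith

lemma smoothness_le_smoothnessScale {Δ β : ℝ} (hΔ : 0 ≤ Δ) (hβ : β ≤ 8 * c ^ 2 * Δ) :
    Lx + 2 * Lxy * Ltxy / μ + Ly * Ltxy ^ 2 / μ ^ 2
      + curvature Ltxy ρxy ρyy μ * (1 + Ltxy / μ) * β
      ≤ 8 * c ^ 4 * smoothnessScale ρxy ρyy μ Δ := by
  have hμ := h.μ_pos
  have := h.Lx_nonneg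
  have := h.Lxy_nonneg
  have := h.Ly_nonneg
  have := h.Ltxy_nonneg
  have := h.curvature_nonneg
  have hc₁ : 1 ≤ c := by linarith
  have hcurv := h.curvature_mul_le hc
  calc _ ≤ 4 * c ^ 3 / μ ^ 2 + c ^ 2 * (ρyy / μ ^ 3 + ρxy / μ ^ 2) * (8 * c ^ 2 * Δ) := by
        refine add_le_add (h.smoothness_constant_part_le hc) ?_
        exact (mul_le_mul_of_nonneg_left hβ (by positivity)).trans
          (mul_le_mul_of_nonneg_right hcurv (by positivity))
    _ ≤ 8 * c ^ 4 / μ ^ 2 + c ^ 2 * (ρyy / μ ^ 3 + ρxy / μ ^ 2) * (8 * c ^ 2 * Δ) := by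
        gcongr <;> norm_num
    _ = _ := by rw [smoothnessScale]; ring

lemma gap_le_smoothnessScale {xs : Euc p} (hxs : ∀ u, totalObj f g xs ≤ totalObj f g u) (ε : ℝ) :
    totalObj f g 0 - totalObj f g xs
      ≤ 8 * c ^ 4 * smoothnessScale ρxy ρyy μ (deltaCSC f g μ ε xs) / 2 * ‖xs‖ ^ 2 := by
  have := h.Lx_nonneg
  have := h.Lxy_nonneg
  have := h.Ly_nonneg
  have := h.Ltxy_nonneg
  have hμ := h.μ_pos
  have hΔ := deltaCSC_nonneg hμ.le f g ε xs
  have hβ : ‖gradY f xs (innerSol g xs)‖ ≤ 8 * c ^ 2 * deltaCSC f g μ ε xs := by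
    have := norm_gradY_add_norm_div_le_deltaCSC hμ.le f g ε xs
    have : 0 ≤ ‖xs‖ / μ := by positivity
    have hc₁ : 1 ≤ c ^ 2 := one_le_pow₀ (by linarith)
    nlinarith
  have hdescent := le_add_inner_gradient_add_sq h.hasGradientAt_totalObj
    (h.norm_hyperGrad_sub_le xs) 0
  rw [← (h.hasGradientAt_totalObj xs).gradient, gradient_eq_zero_of_forall_le hxs,
    inner_zero_left, zero_sub, norm_neg] at hdescent
  have := mul_le_mul_of_nonneg_right (h.smoothness_le_smoothnessScale hc hΔ hβ) (sq_nonneg ‖xs‖)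
  linarith

end BilevelProblem

/-- A bilevel problem with a minimizer `xs` of its total objective, parameters `ε`, `R` of the
regularization, the accuracy `ε'`, and the resulting smoothness parameter `L`. The last four fields
hold for both choices of `R` and `ε'` in the theorem, `(B ^ 2, ε / 2)` and
`(B, ε ^ 2 / (4 * L + 8 * ε / B))` with `B = ‖xs‖`. -/
structure RegularizedProblem (f g : Euc p → Euc q → ℝ) (Lx Lxy Ly Ltxy Lty ρxy ρyy μ ε R ε' L : ℝ)
    (xs : Euc p) : Prop extends BilevelProblem f g Lx Lxy Ly Ltxy Lty ρxy ρyy μ where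
  ε_pos : 0 < ε
  R_pos : 0 < R
  ε'_pos : 0 < ε'
  isMin : ∀ u, totalObj f g xs ≤ totalObj f g u
  L_eq : L = regSmoothness f g Lx Lxy Ly Ltxy ρxy ρyy μ ε R ε'
  sqrt_R_le : √R ≤ ‖xs‖ + 1
  inv_R_le : R⁻¹ ≤ (1 + ‖xs‖⁻¹) ^ 2
  accuracy_le : ε' / (ε / R) ≤ ‖xs‖ ^ 2
  inv_accuracy_le : ε'⁻¹ ≤ 2 * ε⁻¹ + (4 * L + 8 * (ε / R)) * ε⁻¹ ^ 2

namespace RegularizedProblem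

variable {xs : Euc p} (h : RegularizedProblem f g Lx Lxy Ly Ltxy Lty ρxy ρyy μ ε R ε' L xs)

include h

lemma μx_pos : 0 < ε / R := div_pos h.ε_pos h.R_pos

lemma bilevel_regularize :
    BilevelProblem (regularize f ε R) g (Lx + ε / R) Lxy Ly Ltxy Lty ρxy ρyy μ :=
  h.toBilevelProblem.regularize h.ε_pos.le h.R_pos.le

lemma regMinimizer_le (u : Euc p) :
    totalObj (regularize f ε R) g (regMinimizer f g ε R) ≤ totalObj (regularize f ε R) g u :=
  h.toBilevelProblem.regMinimizer_le h.ε_pos h.R_pos u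

lemma norm_regMinimizer_le : ‖regMinimizer f g ε R‖ ≤ ‖xs‖ :=
  h.toBilevelProblem.norm_regMinimizer_le h.ε_pos h.R_pos h.isMin

lemma norm_regMinimizer_sub_le : ‖regMinimizer f g ε R - xs‖ ≤ 2 * ‖xs‖ := by
  linarith [h.norm_regMinimizer_le, norm_sub_le (regMinimizer f g ε R) xs]

lemma le_L : Lx + ε / R ≤ L :=
  h.L_eq ▸ h.bilevel_regularize.le_smoothnessParam _ _ _

lemma μx_le_L : ε / R ≤ L := (le_add_of_nonneg_left h.Lx_nonneg).trans h.le_L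

lemma L_pos : 0 < L := h.μx_pos.trans_le h.μx_le_L

lemma one_le_sqrt_outer_cond : 1 ≤ √(L / (ε / R)) :=
  Real.one_le_sqrt.2 ((one_le_div h.μx_pos).2 h.μx_le_L)

lemma contraction_nonneg : 0 ≤ 1 - 1 / √(L / (ε / R)) := by
  have hr := h.one_le_sqrt_outer_cond
  exact sub_nonneg.2 ((div_le_one (by positivity)).2 hr)

lemma regularized_gap_le :
    totalObj (regularize f ε R) g 0 - totalObj (regularize f ε R) g (regMinimizer f g ε R)
        + ε / R / 2 * ‖regMinimizer f g ε R‖ ^ 2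
      ≤ totalObj f g 0 - totalObj f g xs := by
  have hR := h.R_pos.ne'
  have hmin := h.isMin (regMinimizer f g ε R)
  have hcoef : ε / (2 * R) = ε / R / 2 := by field_simp
  rw [totalObj_regularize, totalObj_regularize, norm_zero, hcoef]
  linarith

lemma iterateRadius_regularize_le :
    iterateRadius (regularize f ε R) g (ε / R) ε' (regMinimizer f g ε R)
      ≤ 2 * (μ * deltaCSC f g μ ε xs) := by
  have hε := h.ε_pos
  have hR := h.R_pos
  have := h.μx_pos
  have hgap := sub_nonneg.2 (h.isMin 0)
  have hs := norm_add_sqrt_gap_le h.μ_pos f g ε xs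
  have hreg_gap := h.regularized_gap_le
  set Ψ := totalObj f g 0 - totalObj f g xs
  set s := (‖xs‖ + 1) * √Ψ / √ε with hs_def
  have hs₀ : 0 ≤ s := by positivity
  have hRΨ : R * Ψ / ε ≤ s ^ 2 := by
    rw [hs_def, div_pow, mul_pow, Real.sq_sqrt hgap, Real.sq_sqrt hε.le]
    gcongr
    exact (Real.sqrt_le_iff.1 h.sqrt_R_le).2
  have hreg : 2 / (ε / R) * (totalObj (regularize f ε R) g 0
      - totalObj (regularize f ε R) g (regMinimizer f g ε R)) + ‖regMinimizer f g ε R‖ ^ 2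
      ≤ 2 * (R * Ψ / ε) := by
    have := mul_le_mul_of_nonneg_left hreg_gap (show 0 ≤ 2 / (ε / R) by positivity)
    refine (le_of_eq ?_).trans (this.trans_eq ?_) <;> field_simp
  refine (Real.sqrt_le_iff.2 ⟨by positivity, ?_⟩ : _ ≤ 2 * s + ‖xs‖).trans
    (by linarith [norm_nonneg xs])
  nlinarith [h.accuracy_le, mul_nonneg hs₀ (norm_nonneg xs), sq_nonneg s]

lemma norm_gradY_innerSol_add_le (hc : 1 + Lx + Lxy + Ly + Ltxy + μ ≤ c) :
    ‖gradY f (regMinimizer f g ε R) (innerSol g (regMinimizer f g ε R))‖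
        + 3 * (Lxy + Ly * Ltxy / μ)
          * iterateRadius (regularize f ε R) g (ε / R) ε' (regMinimizer f g ε R)
      ≤ 8 * c ^ 2 * deltaCSC f g μ ε xs := by
  have hμ := h.μ_pos
  have := h.Lx_nonneg
  have := h.Lxy_nonneg
  have := h.Ly_nonneg
  have := h.Ltxy_nonneg
  have hc₁ : 1 ≤ c ^ 2 := one_le_pow₀ (by linarith)
  have hΔ := norm_gradY_add_norm_div_le_deltaCSC hμ.le f g ε xs
  have hlip := h.gradY_lipschitz_le hc
  set Δ := deltaCSC f g μ ε xs
  calc _ ≤ ‖gradY f xs (innerSol g xs)‖ + c ^ 2 / μ * (2 * ‖xs‖)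
        + 3 * (c ^ 2 / μ) * (2 * (μ * Δ)) := by
        have hD := h.iterateRadius_regularize_le
        have hD₀ : 0 ≤ iterateRadius (regularize f ε R) g (ε / R) ε' (regMinimizer f g ε R) :=
          Real.sqrt_nonneg _
        refine add_le_add ((h.norm_gradY_innerSol_le _ xs).trans (add_le_add_right ?_ _)) ?_
        · exact mul_le_mul hlip h.norm_regMinimizer_sub_le (norm_nonneg _) (by positivity)
        · gcongr
    _ ≤ 2 * c ^ 2 * (‖gradY f xs (innerSol g xs)‖ + ‖xs‖ / μ) + 6 * c ^ 2 * Δ := by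
        have hgrad := mul_le_mul_of_nonneg_right hc₁ (norm_nonneg (gradY f xs (innerSol g xs)))
        have : 3 * (c ^ 2 / μ) * (2 * (μ * Δ)) = 6 * c ^ 2 * Δ := by field_simp; ring
        have : c ^ 2 / μ * (2 * ‖xs‖) = 2 * c ^ 2 * (‖xs‖ / μ) := by ring
        have : 0 ≤ c ^ 2 * ‖gradY f xs (innerSol g xs)‖ := by positivity
        linarith
    _ ≤ 2 * c ^ 2 * Δ + 6 * c ^ 2 * Δ := by gcongr
    _ = _ := by ring

lemma L_le (hc : 1 + Lx + Lxy + Ly + Ltxy + μ ≤ c) :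
    L ≤ ε / R + 8 * c ^ 4 * smoothnessScale ρxy ρyy μ (deltaCSC f g μ ε xs) := by
  refine le_trans (le_of_eq ?_) (add_le_add_right (h.smoothness_le_smoothnessScale hc
    (deltaCSC_nonneg h.μ_pos.le f g ε xs) (h.norm_gradY_innerSol_add_le hc)) (ε / R))
  rw [h.L_eq, regSmoothness, smoothnessParam, gradY_regularize, iterateRadius, regMinimizer,
    curvature]
  ring

end RegularizedProblem

end Scale

section PowBdd

/-- `a` is nonnegative and at most `W ^ n`: the bookkeeping device by which all quantities of the
problem are seen to be polynomial in the argument of the logarithmic factor. -/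
def PowBdd (W : ℝ) (n : ℕ) (a : ℝ) : Prop := 0 ≤ a ∧ a ≤ W ^ n

namespace PowBdd

variable {W a b : ℝ} {n m : ℕ}

lemma of_le (hb : PowBdd W n b) (ha : 0 ≤ a) (hab : a ≤ b) : PowBdd W n a :=
  ⟨ha, hab.trans hb.2⟩

lemma one (ha : 0 ≤ a) (haW : a ≤ W) : PowBdd W 1 a := ⟨ha, by rwa [pow_one]⟩

lemma mono (ha : PowBdd W n a) (hW : 2 ≤ W) (hnm : n ≤ m) : PowBdd W m a :=
  ⟨ha.1, ha.2.trans (pow_le_pow_right₀ (by linarith) hnm)⟩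

lemma add (ha : PowBdd W n a) (hb : PowBdd W m b) (hW : 2 ≤ W) :
    PowBdd W (max n m + 1) (a + b) := by
  refine ⟨add_nonneg ha.1 hb.1, ?_⟩
  calc a + b ≤ W ^ max n m + W ^ max n m :=
        add_le_add (ha.mono hW (le_max_left n m)).2 (hb.mono hW (le_max_right n m)).2
    _ = W ^ max n m * 2 := (mul_two _).symm
    _ ≤ W ^ (max n m + 1) := by rw [pow_succ]; gcongr

lemma mul (ha : PowBdd W n a) (hb : PowBdd W m b) : PowBdd W (n + m) (a * b) :=
  ⟨mul_nonneg ha.1 hb.1, pow_add W n m ▸ mul_le_mul ha.2 hb.2 hb.1 (ha.1.trans ha.2)⟩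

lemma div (ha : PowBdd W n a) (hb : PowBdd W m b⁻¹) : PowBdd W (n + m) (a / b) :=
  div_eq_mul_inv a b ▸ ha.mul hb

lemma pow (ha : PowBdd W n a) (k : ℕ) : PowBdd W (n * k) (a ^ k) :=
  ⟨pow_nonneg ha.1 k, pow_mul W n k ▸ pow_le_pow_left₀ ha.1 ha.2 k⟩

lemma div_pow (ha : PowBdd W n a) (hb : PowBdd W m b⁻¹) (k : ℕ) :
    PowBdd W (n + m * k) (a / b ^ k) :=
  ha.div (inv_pow b k ▸ hb.pow k)

lemma sqrt (ha : PowBdd W n a) (hW : 2 ≤ W) : PowBdd W n √a :=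
  ⟨Real.sqrt_nonneg a, Real.sqrt_le_iff.2 ⟨ha.1.trans ha.2,
    ha.2.trans (le_self_pow₀ (one_le_pow₀ (by linarith)) two_ne_zero)⟩⟩

lemma inv_pow_mul_le (hab : PowBdd W n (a * b⁻¹)) (hW : 0 < W) (hb : 0 < b) :
    (W ^ n)⁻¹ * a ≤ b := by
  rw [inv_mul_le_iff₀ (by positivity), ← div_le_iff₀ hb]
  exact hab.2

end PowBdd

lemma exp_neg_le_inv_pow {W t : ℝ} (hW : 0 < W) {n : ℕ} (ht : n * Real.log W ≤ t) :
    Real.exp (-t) ≤ (W ^ n)⁻¹ := by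
  rw [Real.exp_neg]
  refine inv_anti₀ (by positivity) ?_
  rw [← Real.exp_log (pow_pos hW n), Real.log_pow]
  exact Real.exp_le_exp.2 ht

end PowBdd

section Accuracy

variable {p q : ℕ} {f g : Euc p → Euc q → ℝ}
  {Lx Lxy Ly Ltxy Lty ρxy ρyy μ ε R ε' c L W : ℝ} {xs : Euc p}

/-- A regularized problem whose parameters and their inverses are bounded by fixed powers of `W`,
the argument of the logarithmic factor up to a constant. -/
structure DominatedProblem (f g : Euc p → Euc q → ℝ)
    (Lx Lxy Ly Ltxy Lty ρxy ρyy μ ε R ε' L c W : ℝ) (xs : Euc p) : Prop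
    extends RegularizedProblem f g Lx Lxy Ly Ltxy Lty ρxy ρyy μ ε R ε' L xs where
  le_c : 1 + Lx + Lxy + Ly + Ltxy + μ ≤ c
  hundred_le : 100 ≤ W
  powBdd_c : PowBdd W 1 c
  powBdd_ε : PowBdd W 1 ε
  powBdd_inv_ε : PowBdd W 1 ε⁻¹
  powBdd_inv_R : PowBdd W 2 R⁻¹
  powBdd_inv_μ : PowBdd W 1 μ⁻¹
  powBdd_Lty : PowBdd W 1 Lty
  powBdd_ρxy : PowBdd W 1 ρxy
  powBdd_ρyy : PowBdd W 1 ρyy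
  powBdd_deltaCSC : PowBdd W 1 (deltaCSC f g μ ε xs)
  powBdd_norm_innerSol : PowBdd W 1 ‖innerSol g xs‖

namespace DominatedProblem

variable (h : DominatedProblem f g Lx Lxy Ly Ltxy Lty ρxy ρyy μ ε R ε' L c W xs)

include h

lemma two_le : 2 ≤ W := le_trans (by norm_num) h.hundred_le

lemma W_pos : 0 < W := two_pos.trans_le h.two_le

lemma powBdd_of_le_hundred {a : ℝ} (ha : 0 ≤ a) (ha' : a ≤ 100) : PowBdd W 1 a :=
  .one ha (ha'.trans h.hundred_le)

lemma powBdd_lipschitz : PowBdd W 1 Lxy ∧ PowBdd W 1 Ly ∧ PowBdd W 1 Ltxy ∧ PowBdd W 1 μ := by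
  have := h.Lx_nonneg
  have hLxy := h.Lxy_nonneg
  have hLy := h.Ly_nonneg
  have hLtxy := h.Ltxy_nonneg
  have hμ := h.μ_pos
  have := h.le_c
  exact ⟨h.powBdd_c.of_le hLxy (by linarith), h.powBdd_c.of_le hLy (by linarith),
    h.powBdd_c.of_le hLtxy (by linarith), h.powBdd_c.of_le hμ.le (by linarith)⟩

lemma powBdd_mul_deltaCSC : PowBdd W 2 (μ * deltaCSC f g μ ε xs) :=
  h.powBdd_lipschitz.2.2.2.mul h.powBdd_deltaCSC

lemma powBdd_norm_xs : PowBdd W 2 ‖xs‖ :=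
  h.powBdd_mul_deltaCSC.of_le (norm_nonneg _) (norm_le_mul_deltaCSC h.μ_pos f g ε xs)

lemma powBdd_gap : PowBdd W 5 (totalObj f g 0 - totalObj f g xs) :=
  (h.powBdd_ε.mul (h.powBdd_mul_deltaCSC.pow 2)).of_le (sub_nonneg.2 (h.isMin 0))
    (gap_le_mul_sq_deltaCSC h.μ_pos h.ε_pos h.isMin)

lemma powBdd_iterateRadius :
    PowBdd W 3 (iterateRadius (regularize f ε R) g (ε / R) ε' (regMinimizer f g ε R)) :=
  ((h.powBdd_of_le_hundred (by norm_num) (by norm_num)).mul h.powBdd_mul_deltaCSC).of_le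
    (Real.sqrt_nonneg _) h.iterateRadius_regularize_le

lemma powBdd_μx : PowBdd W 3 (ε / R) := h.powBdd_ε.div h.powBdd_inv_R

lemma powBdd_inv_μx : PowBdd W 7 (ε / R)⁻¹ := by
  have hone := h.powBdd_of_le_hundred zero_le_one (by norm_num)
  have hR : PowBdd W 6 R := ((h.powBdd_norm_xs.add hone h.two_le).pow 2).of_le h.R_pos.le
    (Real.sqrt_le_iff.1 h.sqrt_R_le).2
  exact inv_div ε R ▸ hR.div h.powBdd_inv_ε

lemma powBdd_smoothnessScale :
    PowBdd W 7 (smoothnessScale ρxy ρyy μ (deltaCSC f g μ ε xs)) := by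
  have hone := h.powBdd_of_le_hundred zero_le_one (by norm_num)
  exact ((hone.div_pow h.powBdd_inv_μ 2).add (((h.powBdd_ρyy.div_pow h.powBdd_inv_μ 3).add
    (h.powBdd_ρxy.div_pow h.powBdd_inv_μ 2) h.two_le).mul h.powBdd_deltaCSC) h.two_le)

lemma powBdd_L : PowBdd W 13 L := by
  have height := h.powBdd_of_le_hundred (a := 8) (by norm_num) (by norm_num)
  exact (h.powBdd_μx.add ((height.mul (h.powBdd_c.pow 4)).mul h.powBdd_smoothnessScale)
    h.two_le).of_le h.L_pos.le (h.L_le h.le_c)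

lemma powBdd_inv_L : PowBdd W 7 L⁻¹ :=
  h.powBdd_inv_μx.of_le (inv_nonneg.2 h.L_pos.le) (inv_anti₀ h.μx_pos h.μx_le_L)

lemma powBdd_inv_accuracy : PowBdd W 18 ε'⁻¹ := by
  have htwo := h.powBdd_of_le_hundred (a := 2) (by norm_num) (by norm_num)
  have hfour := h.powBdd_of_le_hundred (a := 4) (by norm_num) (by norm_num)
  have height := h.powBdd_of_le_hundred (a := 8) (by norm_num) (by norm_num)
  exact ((htwo.mul h.powBdd_inv_ε).add (((hfour.mul h.powBdd_L).add (height.mul h.powBdd_μx)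
    h.two_le).mul (h.powBdd_inv_ε.pow 2)) h.two_le).of_le (inv_nonneg.2 h.ε'_pos.le)
    h.inv_accuracy_le

lemma powBdd_sqrt_outer_cond : PowBdd W 20 √(L / (ε / R)) :=
  (h.powBdd_L.div h.powBdd_inv_μx).sqrt h.two_le

lemma powBdd_sqrt_inner_cond : PowBdd W 2 √(Lty / μ) :=
  (h.powBdd_Lty.div h.powBdd_inv_μ).sqrt h.two_le

lemma powBdd_norm_sub {x : Euc p} (hx : ‖x - regMinimizer f g ε R‖
      ≤ 3 * iterateRadius (regularize f ε R) g (ε / R) ε' (regMinimizer f g ε R)) :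
    PowBdd W 5 ‖x - xs‖ := by
  have htwo := h.powBdd_of_le_hundred (a := 2) (by norm_num) (by norm_num)
  have hthree := h.powBdd_of_le_hundred (a := 3) (by norm_num) (by norm_num)
  refine ((hthree.mul h.powBdd_iterateRadius).add (htwo.mul h.powBdd_norm_xs) h.two_le).of_le
    (norm_nonneg _) ?_
  exact (norm_sub_le_norm_sub_add_norm_sub x (regMinimizer f g ε R) xs).trans
    (add_le_add hx h.norm_regMinimizer_sub_le)

lemma norm_gradY_innerSol_le_pow {x : Euc p} (hx : PowBdd W 5 ‖x - xs‖) :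
    ‖gradY f x (innerSol g x)‖ ≤ W ^ 10 := by
  obtain ⟨hLxy, hLy, hLtxy, -⟩ := h.powBdd_lipschitz
  have hgradY : PowBdd W 1 ‖gradY f xs (innerSol g xs)‖ :=
    h.powBdd_deltaCSC.of_le (norm_nonneg _) ((le_add_of_nonneg_right
      (div_nonneg (norm_nonneg xs) h.μ_pos.le)).trans
        (norm_gradY_add_norm_div_le_deltaCSC h.μ_pos.le f g ε xs))
  exact (h.norm_gradY_innerSol_le x xs).trans (hgradY.add
    ((hLxy.add ((hLy.mul hLtxy).div h.powBdd_inv_μ) h.two_le).mul hx) h.two_le).2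

lemma norm_innerSol_le_pow {x : Euc p} (hx : PowBdd W 5 ‖x - xs‖) :
    ‖innerSol g x‖ ≤ W ^ 8 :=
  (h.norm_innerSol_le x xs).trans (h.powBdd_norm_innerSol.add
    ((h.powBdd_lipschitz.2.2.1.div h.powBdd_inv_μ).mul hx) h.two_le).2

lemma powBdd_innerErrorConst :
    PowBdd W 28 (innerErrorConst Lxy Ly Ltxy Lty ρxy ρyy μ (W ^ 10) (W ^ 8)) := by
  have hW := h.two_le
  have htwo := h.powBdd_of_le_hundred (a := 2) (by norm_num) (by norm_num)
  have h18 := h.powBdd_of_le_hundred (a := 18) (by norm_num) (by norm_num)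
  have hpow n : PowBdd W n (W ^ n) := ⟨pow_nonneg h.W_pos.le n, le_rfl⟩
  obtain ⟨hLxy, hLy, hLtxy, -⟩ := h.powBdd_lipschitz
  have hμ := h.powBdd_inv_μ
  have hcurv : PowBdd W 5 (curvature Ltxy ρxy ρyy μ) :=
    ((hLtxy.mul h.powBdd_ρyy).div_pow hμ 2).add (h.powBdd_ρxy.div hμ) hW
  have hy : PowBdd W 11 (2 * √(Lty / μ) * W ^ 8) :=
    (htwo.mul h.powBdd_sqrt_inner_cond).mul (hpow 8)
  exact (((hLxy.add ((hLtxy.mul hLy).div hμ) hW).add (hcurv.mul (hpow 10)) hW).mul hy).add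
    (hLtxy.mul ((h18.mul h.powBdd_sqrt_inner_cond).mul
      (((hpow 10).add (hLy.mul hy) hW).div hμ))) hW

lemma exp_neg_div_le {n : ℕ} (hn : 200 * √(Lty / μ) * Real.log W ≤ n) :
    Real.exp (-(n / (2 * √(Lty / μ)))) ≤ (W ^ 100)⁻¹ := by
  have hr : 0 < √(Lty / μ) := Real.sqrt_pos.2 (div_pos (h.μ_pos.trans_le h.μ_le_Lty) h.μ_pos)
  refine exp_neg_le_inv_pow h.W_pos ?_
  rw [le_div_iff₀ (by positivity)]
  push_cast
  linarith

lemma norm_accBiOGrad_sub_hyperGrad_le_inv_pow {M N : ℕ}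
    (hM : 200 * √(Lty / μ) * Real.log W ≤ M) (hN : 200 * √(Lty / μ) * Real.log W ≤ N)
    {x : Euc p} (hx : ‖x - regMinimizer f g ε R‖
      ≤ 3 * iterateRadius (regularize f ε R) g (ε / R) ε' (regMinimizer f g ε R)) :
    ‖accBiOGrad (regularize f ε R) g Lty μ M N x - hyperGrad (regularize f ε R) g x‖
      ≤ (W ^ 50)⁻¹ := by
  have hW := h.W_pos
  have hxs := h.powBdd_norm_sub hx
  have hβ : ‖gradY (regularize f ε R) x (innerSol g x)‖ ≤ W ^ 10 :=
    gradY_regularize f ε R x _ ▸ h.norm_gradY_innerSol_le_pow hxs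
  calc _ ≤ innerErrorConst Lxy Ly Ltxy Lty ρxy ρyy μ (W ^ 10) (W ^ 8) * (W ^ 100)⁻¹ :=
        h.bilevel_regularize.norm_accBiOGrad_sub_hyperGrad_le hβ (h.norm_innerSol_le_pow hxs)
          (h.exp_neg_div_le hM) (h.exp_neg_div_le hN)
    _ ≤ W ^ 50 * (W ^ 100)⁻¹ := by
        gcongr
        exact (h.powBdd_innerErrorConst.mono h.two_le (by norm_num)).2
    _ = (W ^ 50)⁻¹ := by field_simp

lemma inv_pow_mul_radius_le :
    (W ^ 50)⁻¹ * (7 * iterateRadius (regularize f ε R) g (ε / R) ε' (regMinimizer f g ε R)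
      + (W ^ 50)⁻¹ / L) ≤ ε' / 2 / √(L / (ε / R)) := by
  have hW := h.W_pos
  have hL := h.L_pos
  have htwo := h.powBdd_of_le_hundred (a := 2) (by norm_num) (by norm_num)
  have hseven := h.powBdd_of_le_hundred (a := 7) (by norm_num) (by norm_num)
  have hr : 0 < √(L / (ε / R)) := Real.sqrt_pos.2 (div_pos hL h.μx_pos)
  have hinv : (W ^ 50)⁻¹ / L ≤ L⁻¹ := by
    rw [← one_div L]
    gcongr
    exact inv_le_one_of_one_le₀ (one_le_pow₀ (by linarith [h.two_le]))
  have hpow := ((((hseven.mul h.powBdd_iterateRadius).add h.powBdd_inv_L h.two_le).mul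
    (htwo.mul h.powBdd_sqrt_outer_cond)).mul h.powBdd_inv_accuracy).mono h.two_le
      (show _ ≤ 50 by norm_num)
  rw [div_div, le_div_iff₀ (by positivity), mul_assoc]
  refine le_trans ?_ (hpow.inv_pow_mul_le hW h.ε'_pos)
  gcongr

lemma contraction_mul_gap_le {K : ℕ}
    (hK : totalObj f g 0 - totalObj f g xs ≤ ε' / 2 ∨ 200 * √(L / (ε / R)) * Real.log W ≤ K) :
    (1 - 1 / √(L / (ε / R))) ^ K * (totalObj f g 0 - totalObj f g xs) ≤ ε' / 2 := by
  have hW := h.W_pos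
  have hgap := sub_nonneg.2 (h.isMin 0)
  have hr := h.one_le_sqrt_outer_cond
  have hq := h.contraction_nonneg
  rcases hK with hK | hK
  · exact (mul_le_of_le_one_left hgap
      (pow_le_one₀ hq (sub_le_self _ (by positivity)))).trans hK
  · have hlog : 0 ≤ Real.log W := Real.log_nonneg (by linarith [h.two_le])
    have hexp : (1 - 1 / √(L / (ε / R))) ^ K ≤ (W ^ 100)⁻¹ := by
      refine (pow_le_exp_neg_mul hq le_rfl K).trans (exp_neg_le_inv_pow hW ?_)
      rw [mul_one_div, le_div_iff₀ (by positivity)]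
      push_cast
      have : 0 ≤ √(L / (ε / R)) * Real.log W := by positivity
      linarith
    have htwo := h.powBdd_of_le_hundred (a := 2) (by norm_num) (by norm_num)
    have hpow : PowBdd W 100 (2 * (totalObj f g 0 - totalObj f g xs) * ε'⁻¹) :=
      ((htwo.mul h.powBdd_gap).mul h.powBdd_inv_accuracy).mono h.two_le (by norm_num)
    have := hpow.inv_pow_mul_le hW h.ε'_pos
    have := mul_le_mul_of_nonneg_right hexp hgap
    linarith

theorem accBiO_regularize_gap_le {K M N : ℕ}
    (hK : totalObj f g 0 - totalObj f g xs ≤ ε' / 2 ∨ 200 * √(L / (ε / R)) * Real.log W ≤ K)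
    (hM : 200 * √(Lty / μ) * Real.log W ≤ M) (hN : 200 * √(Lty / μ) * Real.log W ≤ N) :
    totalObj (regularize f ε R) g (accBiO (regularize f ε R) g Lty μ L (ε / R) M N K).z
      - totalObj (regularize f ε R) g (regMinimizer f g ε R) ≤ ε' := by
  refine (h.bilevel_regularize.accBiO_gap_le h.μx_pos (le_add_of_nonneg_left h.Lx_nonneg) h.ε'_pos
    (h.strongConvexOn_regularize ε R) h.regMinimizer_le h.L_eq
    (fun x hx => h.norm_accBiOGrad_sub_hyperGrad_le_inv_pow hM hN hx)
    h.inv_pow_mul_radius_le K).trans ?_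
  have := mul_le_mul_of_nonneg_left h.regularized_gap_le (pow_nonneg h.contraction_nonneg K)
  linarith [h.contraction_mul_gap_le hK]

end DominatedProblem

end Accuracy

section Complexity

variable {p q : ℕ} {f g : Euc p → Euc q → ℝ}
  {Lx Lxy Ly Ltxy Lty ρxy ρyy μ ε R ε' c L τ : ℝ} {xs : Euc p}

namespace RegularizedProblem

variable (h : RegularizedProblem f g Lx Lxy Ly Ltxy Lty ρxy ρyy μ ε R ε' L xs)

include h

lemma exp_logFactor : Real.exp (logFactor f g Lty ρxy ρyy μ ε xs)
    = 2 + ε + 1 / ε + 1 / ‖xs‖ + 1 / μ + Lty + ρxy + ρyy + deltaCSC f g μ ε xs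
      + ‖innerSol g xs‖ := by
  have := h.ε_pos
  have hμ := h.μ_pos
  have := hμ.trans_le h.μ_le_Lty
  have := h.ρxy_nonneg
  have := h.ρyy_nonneg
  have := deltaCSC_nonneg hμ.le f g ε xs
  rw [logFactor, Real.exp_log (by positivity)]

lemma two_le_exp_logFactor : 2 ≤ Real.exp (logFactor f g Lty ρxy ρyy μ ε xs) := by
  have := h.ε_pos
  have hμ := h.μ_pos
  have := hμ.trans_le h.μ_le_Lty
  have := h.ρxy_nonneg
  have := h.ρyy_nonneg
  have := deltaCSC_nonneg hμ.le f g ε xs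
  rw [h.exp_logFactor]
  simp only [add_assoc]
  exact le_add_of_nonneg_right (by positivity)

lemma dominatedProblem (hc : 1 + Lx + Lxy + Ly + Ltxy + μ ≤ c) :
    DominatedProblem f g Lx Lxy Ly Ltxy Lty ρxy ρyy μ ε R ε' L c
      (100 * c * Real.exp (logFactor f g Lty ρxy ρyy μ ε xs)) xs := by
  have := h.Lx_nonneg
  have := h.Lxy_nonneg
  have := h.Ly_nonneg
  have := h.Ltxy_nonneg
  have hμ := h.μ_pos
  have hε := h.ε_pos
  have hLty := hμ.trans_le h.μ_le_Lty
  have hρxy := h.ρxy_nonneg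
  have hρyy := h.ρyy_nonneg
  have hΔ := deltaCSC_nonneg hμ.le f g ε xs
  have hy := norm_nonneg (innerSol g xs)
  have hX := h.exp_logFactor
  have hX_two := h.two_le_exp_logFactor
  have : 0 < 1 / ε := by positivity
  have : 0 < 1 / μ := by positivity
  have : 0 ≤ 1 / ‖xs‖ := by positivity
  have hcX := le_mul_of_one_le_left (Real.exp_pos (logFactor f g Lty ρxy ρyy μ ε xs)).le
    (show 1 ≤ c by linarith)
  have hcX' := mul_le_mul_of_nonneg_left hX_two (show 0 ≤ c by linarith)
  exact
  { toRegularizedProblem := h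
    le_c := hc
    hundred_le := by linarith
    powBdd_c := .one (by linarith) (by linarith)
    powBdd_ε := .one hε.le (by linarith)
    powBdd_inv_ε := one_div ε ▸ .one (by positivity) (by linarith)
    powBdd_inv_R := ⟨inv_nonneg.2 h.R_pos.le, h.inv_R_le.trans
      (pow_le_pow_left₀ (by positivity) (one_div ‖xs‖ ▸ (by linarith)) 2)⟩
    powBdd_inv_μ := one_div μ ▸ .one (by positivity) (by linarith)
    powBdd_Lty := .one hLty.le (by linarith)
    powBdd_ρxy := .one hρxy (by linarith)
    powBdd_ρyy := .one hρyy (by linarith)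
    powBdd_deltaCSC := .one hΔ (by linarith)
    powBdd_norm_innerSol := .one hy (by linarith) }

lemma log_mul_exp_logFactor_le (hc : 1 ≤ c) :
    Real.log (100 * c * Real.exp (logFactor f g Lty ρxy ρyy μ ε xs))
      ≤ (1 + Real.log (100 * c) / Real.log 2) * logFactor f g Lty ρxy ρyy μ ε xs := by
  have hlog_two : 0 < Real.log 2 := Real.log_pos one_lt_two
  have hlog_c : 0 ≤ Real.log (100 * c) := Real.log_nonneg (by linarith)
  have hℓ := (Real.log_le_iff_le_exp two_pos).2 h.two_le_exp_logFactor
  rw [Real.log_mul (by positivity) (Real.exp_pos _).ne', Real.log_exp, add_mul, one_mul, add_comm]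
  refine add_le_add_right ?_ _
  rw [div_mul_eq_mul_div, le_div_iff₀ hlog_two]
  gcongr

/-- Below the threshold the regularization no longer dominates the smoothness constant, which is
then comparable to the unregularized one. -/
lemma sqrt_cond_mul_sqrt_cond_le (hc : 1 + Lx + Lxy + Ly + Ltxy + μ ≤ c)
    (hthr : ε / R ≤ 16 * (8 * c ^ 4 * smoothnessScale ρxy ρyy μ (deltaCSC f g μ ε xs))) :
    √(L / (ε / R)) * √(Lty / μ) ≤ √(17 * (8 * c ^ 4))
      * √(smoothnessScale ρxy ρyy μ (deltaCSC f g μ ε xs) * R * Lty / (ε * μ)) := by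
  have hμ := h.μ_pos
  have hε := h.ε_pos
  have hR := h.R_pos
  have hLty := hμ.trans_le h.μ_le_Lty
  have hL := h.L_le hc
  rw [← Real.sqrt_mul (div_nonneg h.L_pos.le h.μx_pos.le), ← Real.sqrt_mul (by positivity)]
  refine Real.sqrt_le_sqrt ?_
  set A := smoothnessScale ρxy ρyy μ (deltaCSC f g μ ε xs)
  calc L / (ε / R) * (Lty / μ) ≤ 17 * (8 * c ^ 4 * A) / (ε / R) * (Lty / μ) := by
        gcongr
        linarith
    _ = _ := by field_simp

end RegularizedProblem

/-- The constant of the complexity bounds; `c` bounds the Lipschitz constants and `μ`. -/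
noncomputable def complexityConst (c τ : ℝ) : ℝ :=
  203 ^ 2 * (τ + 1) * (1 + Real.log (100 * c) / Real.log 2) ^ 2 * √(17 * (8 * c ^ 4))

lemma complexityConst_pos (hc : 1 ≤ c) (hτ : 0 < τ) : 0 < complexityConst c τ := by
  have : 0 ≤ Real.log (100 * c) := Real.log_nonneg (by linarith)
  have : 0 < Real.log 2 := Real.log_pos one_lt_two
  unfold complexityConst
  positivity

lemma cost_accBiO_ceil_le (hτ : 0 ≤ τ) (f g : Euc p → Euc q → ℝ) (Lty μ L μx : ℝ) {rx ry l : ℝ}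
    (hrx : 1 ≤ rx) (hry : 1 ≤ ry) (hl : 1 ≤ l) :
    (accBiO f g Lty μ L μx ⌈200 * ry * l⌉₊ ⌈200 * ry * l⌉₊ ⌈200 * rx * l⌉₊).count.cost τ
      ≤ 203 ^ 2 * (τ + 1) * (rx * ry) * l ^ 2 := by
  have hx : 1 ≤ rx * l := one_le_mul_of_one_le_of_one_le hrx hl
  have hy : 1 ≤ ry * l := one_le_mul_of_one_le_of_one_le hry hl
  have hK := (Nat.ceil_lt_add_one (show 0 ≤ 200 * rx * l by positivity)).le
  have hM := (Nat.ceil_lt_add_one (show 0 ≤ 200 * ry * l by positivity)).le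
  refine (cost_accBiO_le hτ f g Lty μ L μx _ _ _).trans ?_
  have hstep : τ * (1 + (⌈200 * ry * l⌉₊ : ℝ)) + (⌈200 * ry * l⌉₊ + 2)
      ≤ 203 * (τ + 1) * (ry * l) := by
    have := mul_le_mul_of_nonneg_left
      (show 1 + (⌈200 * ry * l⌉₊ : ℝ) ≤ 203 * (ry * l) by linarith) hτ
    linarith
  calc _ ≤ 203 * (rx * l) * (203 * (τ + 1) * (ry * l)) :=
        mul_le_mul (by linarith) hstep (by positivity) (by positivity)
    _ = _ := by ring

namespace RegularizedProblem

variable (h : RegularizedProblem f g Lx Lxy Ly Ltxy Lty ρxy ρyy μ ε R ε' L xs)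
  (hc : 1 + Lx + Lxy + Ly + Ltxy + μ ≤ c)

include h hc

lemma cost_accBiO_regularize_le (hτ : 0 < τ)
    (hthr : ε / R ≤ 16 * (8 * c ^ 4 * smoothnessScale ρxy ρyy μ (deltaCSC f g μ ε xs)))
    {l : ℝ} (hl : l = Real.log (100 * c * Real.exp (logFactor f g Lty ρxy ρyy μ ε xs))) :
    (accBiO (regularize f ε R) g Lty μ L (ε / R) ⌈200 * √(Lty / μ) * l⌉₊
        ⌈200 * √(Lty / μ) * l⌉₊ ⌈200 * √(L / (ε / R)) * l⌉₊).count.cost τ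
      ≤ complexityConst c τ
        * √(smoothnessScale ρxy ρyy μ (deltaCSC f g μ ε xs) * R * Lty / (ε * μ))
        * logFactor f g Lty ρxy ρyy μ ε xs ^ 2 := by
  have hμ := h.μ_pos
  have hc_one : 1 ≤ c := by
    linarith [h.Lx_nonneg, h.Lxy_nonneg, h.Ly_nonneg, h.Ltxy_nonneg]
  have hl_one : 1 ≤ l := by
    have hW := (h.dominatedProblem hc).hundred_le
    rw [hl, Real.le_log_iff_exp_le (by linarith)]
    linarith [Real.exp_one_lt_d9]
  have hry : 1 ≤ √(Lty / μ) := Real.one_le_sqrt.2 ((one_le_div hμ).2 h.μ_le_Lty)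
  refine (cost_accBiO_ceil_le hτ.le _ _ _ _ _ _ h.one_le_sqrt_outer_cond hry hl_one).trans ?_
  have hcond := h.sqrt_cond_mul_sqrt_cond_le hc hthr
  have hlog := hl.trans_le (h.log_mul_exp_logFactor_le hc_one)
  set ℓ := logFactor f g Lty ρxy ρyy μ ε xs
  set S := √(smoothnessScale ρxy ρyy μ (deltaCSC f g μ ε xs) * R * Lty / (ε * μ))
  calc _ ≤ 203 ^ 2 * (τ + 1) * (√(17 * (8 * c ^ 4)) * S)
        * ((1 + Real.log (100 * c) / Real.log 2) * ℓ) ^ 2 := by gcongr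
    _ = _ := by rw [complexityConst]; ring

/-- When the regularization dominates the smoothness constant, the starting point is already
accurate enough and no iteration is needed. -/
theorem exists_accBiO_complexity (hτ : 0 < τ)
    (hthr : 16 * (8 * c ^ 4 * smoothnessScale ρxy ρyy μ (deltaCSC f g μ ε xs)) ≤ ε / R →
      totalObj f g 0 - totalObj f g xs ≤ ε' / 2) :
    ∃ K M N : ℕ,
      (accBiO (regularize f ε R) g Lty μ L (ε / R) M N K).count.cost τ
        ≤ complexityConst c τ
          * √(smoothnessScale ρxy ρyy μ (deltaCSC f g μ ε xs) * R * Lty / (ε * μ))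
          * logFactor f g Lty ρxy ρyy μ ε xs ^ 2 ∧
      ∀ K' M' N' : ℕ, K ≤ K' → M ≤ M' → N ≤ N' →
        totalObj (regularize f ε R) g (accBiO (regularize f ε R) g Lty μ L (ε / R) M' N' K').z
          - totalObj (regularize f ε R) g (regMinimizer f g ε R) ≤ ε' := by
  obtain ⟨l, hl⟩ : ∃ l, l = Real.log (100 * c * Real.exp (logFactor f g Lty ρxy ρyy μ ε xs)) :=
    ⟨_, rfl⟩
  have hgap {K M N : ℕ} := (h.dominatedProblem hc).accBiO_regularize_gap_le
    (K := K) (M := M) (N := N)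
  rw [← hl] at hgap
  rcases le_total (16 * (8 * c ^ 4 * smoothnessScale ρxy ρyy μ (deltaCSC f g μ ε xs))) (ε / R)
    with hcase | hcase
  · refine ⟨0, ⌈200 * √(Lty / μ) * l⌉₊, ⌈200 * √(Lty / μ) * l⌉₊,
      (cost_accBiO_le hτ.le _ _ _ _ _ _ _ _ _).trans ?_, fun K' M' N' _ hM hN =>
        hgap (.inl (hthr hcase)) (Nat.ceil_le.1 hM) (Nat.ceil_le.1 hN)⟩
    have hC := complexityConst_pos (c := c) (by
      linarith [h.Lx_nonneg, h.Lxy_nonneg, h.Ly_nonneg, h.Ltxy_nonneg, h.μ_pos]) hτ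
    rw [Nat.cast_zero, zero_mul]
    positivity
  · exact ⟨⌈200 * √(L / (ε / R)) * l⌉₊, ⌈200 * √(Lty / μ) * l⌉₊, ⌈200 * √(Lty / μ) * l⌉₊,
      h.cost_accBiO_regularize_le hc hτ hcase hl, fun K' M' N' hK hM hN =>
        hgap (.inr (Nat.ceil_le.1 hK)) (Nat.ceil_le.1 hM) (Nat.ceil_le.1 hN)⟩

end RegularizedProblem

lemma sqrt_add_le_sqrt_add_sqrt {a b : ℝ} (ha : 0 ≤ a) (hb : 0 ≤ b) : √(a + b) ≤ √a + √b := by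
  simpa only [Real.sqrt_eq_rpow] using
    Real.rpow_add_le_add_rpow ha hb one_half_pos.le one_half_lt_one.le

lemma sqrt_smoothnessScale_le (hμ : 0 < μ) (hLty : 0 ≤ Lty) (hρxy : 0 ≤ ρxy) (hρyy : 0 ≤ ρyy)
    (hε : 0 < ε) (hR : 0 ≤ R) {Δ : ℝ} (hΔ : 0 ≤ Δ) :
    √(smoothnessScale ρxy ρyy μ Δ * R * Lty / (ε * μ))
      ≤ √(R * Lty / (ε * μ ^ 3))
        + (√(R * ρyy * Lty / (ε * μ ^ 4)) + √(R * ρxy * Lty / (ε * μ ^ 3))) * √Δ := by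
  calc √(smoothnessScale ρxy ρyy μ Δ * R * Lty / (ε * μ))
      = √(R * Lty / (ε * μ ^ 3)
          + (R * ρyy * Lty / (ε * μ ^ 4) + R * ρxy * Lty / (ε * μ ^ 3)) * Δ) := by
        rw [smoothnessScale]
        field_simp
    _ ≤ √(R * Lty / (ε * μ ^ 3))
          + √((R * ρyy * Lty / (ε * μ ^ 4) + R * ρxy * Lty / (ε * μ ^ 3)) * Δ) :=
        sqrt_add_le_sqrt_add_sqrt (by positivity) (by positivity)
    _ ≤ _ := by
        rw [Real.sqrt_mul' _ hΔ]
        gcongr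
        exact sqrt_add_le_sqrt_add_sqrt (by positivity) (by positivity)

lemma existsUnique_eq_of_antitoneOn {F : ℝ → ℝ} (hpos : ∀ x, 0 < F x)
    (hcont : ContinuousOn F (Ici 0)) (hanti : AntitoneOn F (Ici 0)) : ∃! x, x = F x := by
  obtain ⟨x, -, hx⟩ := exists_mem_Icc_isFixedPt (hcont.mono Icc_subset_Ici_self) (hpos 0).le
    (hpos 0).le (hanti self_mem_Ici (hpos 0).le (hpos 0).le)
  refine ⟨x, hx.symm, fun y hy => ?_⟩
  have hmem {z : ℝ} (hz : z = F z) : z ∈ Ici 0 := hz ▸ (hpos z).le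
  rcases le_total x y with hle | hle
  · exact le_antisymm (hy.trans_le ((hanti (hmem hx.symm) (hmem hy) hle).trans_eq hx)) hle
  · exact le_antisymm hle (hx.symm.trans_le ((hanti (hmem hy) (hmem hx.symm) hle).trans_eq hy.symm))

lemma existsUnique_eq_add_mul_sqrt {a b d s t m : ℝ} (ha : 0 < a) (hb : 0 ≤ b) (hs : 0 ≤ s)
    (ht : 0 < t) (hm : 0 ≤ m) : ∃! L : ℝ, L = a + b * √(d + s / (4 * L + t) / m) := by
  refine existsUnique_eq_of_antitoneOn (fun L => by positivity) ?_ ?_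
  · have hne : ∀ L ∈ Ici (0 : ℝ), 4 * L + t ≠ 0 := fun L (hL : 0 ≤ L) => by positivity
    fun_prop (disch := assumption)
  · intro L (hL : 0 ≤ L) L' _ hLL'
    dsimp only
    gcongr

lemma BilevelProblem.existsUnique_eq_regSmoothness
    (h : BilevelProblem f g Lx Lxy Ly Ltxy Lty ρxy ρyy μ) (hε : 0 < ε) (hR : 0 < R) :
    ∃! L : ℝ, L = regSmoothness f g Lx Lxy Ly Ltxy ρxy ρyy μ ε R
      (ε ^ 2 / (4 * L + 8 * ε / R)) := by
  have := h.Lx_nonneg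
  have := h.Lxy_nonneg
  have := h.Ly_nonneg
  have := h.Ltxy_nonneg
  have := h.ρxy_nonneg
  have := h.ρyy_nonneg
  have := h.μ_pos
  exact existsUnique_eq_add_mul_sqrt (by positivity) (by positivity) (by positivity)
    (by positivity) (by positivity)

end Complexity

section Conclusion

variable {p q : ℕ} {f g : Euc p → Euc q → ℝ}
  {Lx Lxy Ly Ltxy Lty ρxy ρyy μ ε R ε' c L τ : ℝ} {xs : Euc p}

namespace RegularizedProblem

variable (h : RegularizedProblem f g Lx Lxy Ly Ltxy Lty ρxy ρyy μ ε R ε' L xs)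

include h

lemma totalObj_sub_le (hR : ‖xs‖ ^ 2 ≤ R) {z : Euc p}
    (hz : totalObj (regularize f ε R) g z
      - totalObj (regularize f ε R) g (regMinimizer f g ε R) ≤ ε') :
    totalObj f g z - totalObj f g xs ≤ ε' + ε / 2 := by
  have hε := h.ε_pos
  have hR₀ := h.R_pos
  have hmin := h.regMinimizer_le xs
  rw [totalObj_regularize f g ε R xs] at hmin
  rw [totalObj_regularize f g ε R z] at hz
  have hxs : ε / (2 * R) * ‖xs‖ ^ 2 ≤ ε / 2 := by
    calc ε / (2 * R) * ‖xs‖ ^ 2 ≤ ε / (2 * R) * R := by gcongr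
      _ = ε / 2 := by field_simp
  have : 0 ≤ ε / (2 * R) * ‖z‖ ^ 2 := by positivity
  linarith

lemma hasGradientAt_regMinimizer :
    HasGradientAt (totalObj (regularize f ε R) g) 0 (regMinimizer f g ε R) := by
  have hgrad := h.bilevel_regularize.hasGradientAt_totalObj (regMinimizer f g ε R)
  rwa [← hgrad.gradient, gradient_eq_zero_of_forall_le h.regMinimizer_le] at hgrad

lemma sq_norm_hyperGrad_regularize_le {z : Euc p}
    (hz : totalObj (regularize f ε R) g z
      - totalObj (regularize f ε R) g (regMinimizer f g ε R) ≤ ε') :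
    ‖hyperGrad (regularize f ε R) g z‖ ^ 2 ≤ 2 * L * ε' := by
  have hball := norm_sub_le_three_mul_iterateRadius h.μx_pos (h.strongConvexOn_regularize ε R)
    h.regMinimizer_le h.hasGradientAt_regMinimizer hz
  have hsmooth (u : Euc p) : ‖hyperGrad (regularize f ε R) g u - hyperGrad (regularize f ε R) g z‖
      ≤ L * ‖u - z‖ :=
    h.L_eq ▸ h.bilevel_regularize.norm_hyperGrad_sub_le_smoothnessParam hball u
  exact (sq_norm_gradient_le_of_forall_le h.bilevel_regularize.hasGradientAt_totalObj h.L_pos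
    hsmooth h.regMinimizer_le).trans
      (mul_le_mul_of_nonneg_left hz (mul_nonneg zero_le_two h.L_pos.le))

lemma norm_hyperGrad_le (hR : ‖xs‖ ≤ R) (hε' : 2 * L * ε' ≤ ε ^ 2) {z : Euc p}
    (hz : totalObj (regularize f ε R) g z
      - totalObj (regularize f ε R) g (regMinimizer f g ε R) ≤ ε') :
    ‖hyperGrad f g z‖ ≤ 3 * ε := by
  have hε := h.ε_pos
  have hR₀ := h.R_pos
  have hμx := h.μx_pos
  have hreg : ‖hyperGrad (regularize f ε R) g z‖ ≤ ε :=
    le_of_sq_le_sq ((h.sq_norm_hyperGrad_regularize_le hz).trans hε') hε.le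
  have hdist : ε / R * ‖z - regMinimizer f g ε R‖ ≤ ε := by
    have hgap := (sq_norm_sub_le_of_strongConvexOn (h.strongConvexOn_regularize ε R)
      h.hasGradientAt_regMinimizer z).trans hz
    refine le_of_sq_le_sq ?_ hε.le
    calc (ε / R * ‖z - regMinimizer f g ε R‖) ^ 2
        = 2 * (ε / R) * (ε / R / 2 * ‖z - regMinimizer f g ε R‖ ^ 2) := by ring
      _ ≤ 2 * L * ε' := by
        have := h.L_pos
        gcongr
        exact h.μx_le_L
      _ ≤ ε ^ 2 := hε'
  have hz_norm : ε / R * ‖z‖ ≤ 2 * ε := by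
    have hxs : ε / R * ‖xs‖ ≤ ε := by
      rw [div_mul_eq_mul_div, div_le_iff₀ hR₀]
      gcongr
    have := mul_le_mul_of_nonneg_left ((norm_le_norm_sub_add z (regMinimizer f g ε R)).trans
      (add_le_add_right h.norm_regMinimizer_le _)) hμx.le
    linarith
  calc ‖hyperGrad f g z‖ = ‖hyperGrad (regularize f ε R) g z - (ε / R) • z‖ := by
        rw [h.hyperGrad_regularize, add_sub_cancel_right]
    _ ≤ ‖hyperGrad (regularize f ε R) g z‖ + ε / R * ‖z‖ := by
        rw [← norm_smul_of_nonneg hμx.le]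
        exact norm_sub_le _ _
    _ ≤ 3 * ε := by linarith

end RegularizedProblem

lemma accuracy_ge {B : ℝ} (hε : 0 < ε) (hB : 0 < B) (hL : 0 ≤ L) (hLB : L ≤ 2 * (ε / B)) :
    ε * B / 16 ≤ ε ^ 2 / (4 * L + 8 * ε / B) := by
  rw [mul_div_assoc 8, le_div_iff₀ (by positivity)]
  calc ε * B / 16 * (4 * L + 8 * (ε / B)) ≤ ε * B / 16 * (16 * (ε / B)) := by
        gcongr
        linarith
    _ = ε ^ 2 := by field_simp

namespace BilevelProblem

variable (h : BilevelProblem f g Lx Lxy Ly Ltxy Lty ρxy ρyy μ)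

include h

lemma div_le_regSmoothness (hε : 0 ≤ ε) (hR : 0 ≤ R) (ε' : ℝ) :
    ε / R ≤ regSmoothness f g Lx Lxy Ly Ltxy ρxy ρyy μ ε R ε' :=
  (le_add_of_nonneg_left h.Lx_nonneg).trans ((h.regularize hε hR).le_smoothnessParam _ _ _)

lemma regularizedProblem_sq_norm (hε : 0 < ε) (hxs : 0 < ‖xs‖)
    (hmin : ∀ u, totalObj f g xs ≤ totalObj f g u) :
    RegularizedProblem f g Lx Lxy Ly Ltxy Lty ρxy ρyy μ ε (‖xs‖ ^ 2) (ε / 2)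
      (regSmoothness f g Lx Lxy Ly Ltxy ρxy ρyy μ ε (‖xs‖ ^ 2) (ε / 2)) xs where
  __ := h
  ε_pos := hε
  R_pos := by positivity
  ε'_pos := by positivity
  isMin := hmin
  L_eq := rfl
  sqrt_R_le := by
    rw [Real.sqrt_sq hxs.le]
    linarith
  inv_R_le := by
    rw [← inv_pow]
    gcongr
    linarith
  accuracy_le := by
    have : ε / 2 / (ε / ‖xs‖ ^ 2) = ‖xs‖ ^ 2 / 2 := by field_simp
    rw [this]
    exact half_le_self (sq_nonneg _)
  inv_accuracy_le := by
    have hL := h.div_le_regSmoothness hε.le (sq_nonneg ‖xs‖) (ε / 2)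
    have : 0 < ε / ‖xs‖ ^ 2 := by positivity
    rw [inv_div, div_eq_mul_inv]
    exact le_add_of_nonneg_right (mul_nonneg (by linarith) (by positivity))

lemma regularizedProblem_norm (hε : 0 < ε) (hxs : 0 < ‖xs‖)
    (hmin : ∀ u, totalObj f g xs ≤ totalObj f g u)
    (hL : L = regSmoothness f g Lx Lxy Ly Ltxy ρxy ρyy μ ε ‖xs‖ (ε ^ 2 / (4 * L + 8 * ε / ‖xs‖))) :
    RegularizedProblem f g Lx Lxy Ly Ltxy Lty ρxy ρyy μ ε ‖xs‖ (ε ^ 2 / (4 * L + 8 * ε / ‖xs‖))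
      L xs := by
  have hμx : 0 < ε / ‖xs‖ := by positivity
  have hL₀ : 0 < L := hμx.trans_le (hL ▸ h.div_le_regSmoothness hε.le hxs.le _)
  exact
  { __ := h
    ε_pos := hε
    R_pos := hxs
    ε'_pos := by positivity
    isMin := hmin
    L_eq := hL
    sqrt_R_le := Real.sqrt_le_iff.2 ⟨by positivity, by nlinarith⟩
    inv_R_le := by
      have : 0 < ‖xs‖⁻¹ := by positivity
      nlinarith
    accuracy_le := by
      rw [div_div, div_le_iff₀ (by positivity)]
      have : ‖xs‖ ^ 2 * ((4 * L + 8 * ε / ‖xs‖) * (ε / ‖xs‖))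
          = 4 * (‖xs‖ * ε * L) + 8 * ε ^ 2 := by field_simp
      have : 0 ≤ ‖xs‖ * ε * L := by positivity
      nlinarith
    inv_accuracy_le := by
      rw [inv_div, div_eq_mul_inv, mul_div_assoc, inv_pow]
      exact le_add_of_nonneg_left (by positivity) }

theorem exists_accBiO_gap_le (hc : 1 + Lx + Lxy + Ly + Ltxy + μ ≤ c) (hτ : 0 < τ) (hε : 0 < ε)
    (hxs : 0 < ‖xs‖) (hmin : ∀ u, totalObj f g xs ≤ totalObj f g u) :
    ∃ K M N : ℕ,
      (accBiO (regularize f ε (‖xs‖ ^ 2)) g Lty μ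
          (regSmoothness f g Lx Lxy Ly Ltxy ρxy ρyy μ ε (‖xs‖ ^ 2) (ε / 2))
          (ε / ‖xs‖ ^ 2) M N K).count.cost τ
        ≤ complexityConst c τ * (‖xs‖ * (√(Lty / (ε * μ ^ 3))
            + (√(ρyy * Lty / (ε * μ ^ 4)) + √(ρxy * Lty / (ε * μ ^ 3)))
              * √(deltaCSC f g μ ε xs)))
          * logFactor f g Lty ρxy ρyy μ ε xs ^ 2 ∧
      ∀ K' M' N' : ℕ, K ≤ K' → M ≤ M' → N ≤ N' →
        totalObj f g
            (accBiO (regularize f ε (‖xs‖ ^ 2)) g Lty μ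
              (regSmoothness f g Lx Lxy Ly Ltxy ρxy ρyy μ ε (‖xs‖ ^ 2) (ε / 2))
              (ε / ‖xs‖ ^ 2) M' N' K').z
          - totalObj f g xs ≤ ε := by
  have hreg := h.regularizedProblem_sq_norm hε hxs hmin
  have hR := hreg.R_pos
  obtain ⟨K, M, N, hcost, hgap⟩ := hreg.exists_accBiO_complexity hc hτ fun hthr => by
    rw [le_div_iff₀ hR] at hthr
    linarith [h.gap_le_smoothnessScale hc hmin ε, sub_nonneg.2 (hmin 0)]
  refine ⟨K, M, N, hcost.trans ?_, fun K' M' N' hK hM hN =>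
    (hreg.totalObj_sub_le le_rfl (hgap K' M' N' hK hM hN)).trans_eq (add_halves ε)⟩
  have hC := complexityConst_pos (c := c) (by
    linarith [h.Lx_nonneg, h.Lxy_nonneg, h.Ly_nonneg, h.Ltxy_nonneg, h.μ_pos]) hτ
  have hsqrt (a : ℝ) : √(‖xs‖ ^ 2 * a) = ‖xs‖ * √a := by
    rw [Real.sqrt_mul hR.le, Real.sqrt_sq hxs.le]
  gcongr
  refine (sqrt_smoothnessScale_le h.μ_pos (h.μ_pos.le.trans h.μ_le_Lty) h.ρxy_nonneg h.ρyy_nonneg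
    hε hR.le (deltaCSC_nonneg h.μ_pos.le f g ε xs)).trans_eq ?_
  simp only [mul_assoc, mul_div_assoc, hsqrt]
  ring

theorem exists_accBiO_norm_gradient_le (hc : 1 + Lx + Lxy + Ly + Ltxy + μ ≤ c) (hτ : 0 < τ)
    (hε : 0 < ε) (hxs : 0 < ‖xs‖) (hmin : ∀ u, totalObj f g xs ≤ totalObj f g u)
    (hL : L = regSmoothness f g Lx Lxy Ly Ltxy ρxy ρyy μ ε ‖xs‖ (ε ^ 2 / (4 * L + 8 * ε / ‖xs‖))) :
    ∃ K M N : ℕ,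
      (accBiO (regularize f ε ‖xs‖) g Lty μ L (ε / ‖xs‖) M N K).count.cost τ
        ≤ complexityConst c τ * (√(‖xs‖ * Lty / (ε * μ ^ 3))
            + (√(‖xs‖ * ρyy * Lty / (ε * μ ^ 4)) + √(‖xs‖ * ρxy * Lty / (ε * μ ^ 3)))
              * √(deltaCSC f g μ ε xs))
          * logFactor f g Lty ρxy ρyy μ ε xs ^ 2 ∧
      ∀ K' M' N' : ℕ, K ≤ K' → M ≤ M' → N ≤ N' →
        DifferentiableAt ℝ (totalObj f g)
            (accBiO (regularize f ε ‖xs‖) g Lty μ L (ε / ‖xs‖) M' N' K').z ∧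
          ‖gradient (totalObj f g)
            (accBiO (regularize f ε ‖xs‖) g Lty μ L (ε / ‖xs‖) M' N' K').z‖ ≤ 3 * ε := by
  have hreg := h.regularizedProblem_norm hε hxs hmin hL
  have hL₀ := hreg.L_pos
  have hμx := hreg.μx_pos
  obtain ⟨K, M, N, hcost, hgap⟩ := hreg.exists_accBiO_complexity hc hτ fun hthr => by
    have hε' := accuracy_ge hε hxs hL₀.le (by linarith [hreg.L_le hc])
    rw [le_div_iff₀ hxs] at hthr
    nlinarith [h.gap_le_smoothnessScale hc hmin ε]
  refine ⟨K, M, N, hcost.trans ?_, fun K' M' N' hK hM hN => ?_⟩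
  · have hC := complexityConst_pos (c := c) (by
      linarith [h.Lx_nonneg, h.Lxy_nonneg, h.Ly_nonneg, h.Ltxy_nonneg, h.μ_pos]) hτ
    gcongr
    exact sqrt_smoothnessScale_le h.μ_pos (h.μ_pos.le.trans h.μ_le_Lty) h.ρxy_nonneg h.ρyy_nonneg
      hε hxs.le (deltaCSC_nonneg h.μ_pos.le f g ε xs)
  · have hgrad := h.hasGradientAt_totalObj
      (accBiO (regularize f ε ‖xs‖) g Lty μ L (ε / ‖xs‖) M' N' K').z
    refine ⟨hgrad.differentiableAt, ?_⟩
    rw [hgrad.gradient]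
    refine hreg.norm_hyperGrad_le le_rfl ?_ (hgap K' M' N' hK hM hN)
    rw [← mul_div_assoc, div_le_iff₀ (by positivity), mul_comm, mul_div_assoc]
    gcongr
    linarith

end BilevelProblem

end Conclusion

theorem mainTheorem4
    (Lx Lxy Ly Ltxy μbar τ : ℝ) (hLx : 0 ≤ Lx) (hLxy : 0 ≤ Lxy) (hLy : 0 ≤ Ly)
    (hLtxy : 0 ≤ Ltxy) (hμbar : 0 < μbar) (hτ : 0 < τ) :
    ∃ C : ℝ, 0 < C ∧
      ∀ (p q : ℕ) (f g : Euc p → Euc q → ℝ) (Lty ρxy ρyy μy B ε : ℝ) (xs : Euc p),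
        0 < q → 0 ≤ Lty → 0 ≤ ρxy → 0 ≤ ρyy → 0 < μy → μy ≤ μbar → 0 < B → 0 < ε →
        IsConvexStronglyConvex f g Lx Lxy Ly Ltxy Lty ρxy ρyy μy →
        IsMinOn (totalObj f g) univ xs → ‖xs‖ = B →
        -- suboptimality gap: R = B², accuracy ε/2, μx = ε/B²
        (∃ K M N : ℕ,
          (accBiO (regularize f ε (B ^ 2)) g Lty μy
              (regSmoothness f g Lx Lxy Ly Ltxy ρxy ρyy μy ε (B ^ 2) (ε / 2))
              (ε / B ^ 2) M N K).count.cost τ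
            ≤ C * (B * (Real.sqrt (Lty / (ε * μy ^ 3))
                + (Real.sqrt (ρyy * Lty / (ε * μy ^ 4)) + Real.sqrt (ρxy * Lty / (ε * μy ^ 3)))
                  * Real.sqrt (deltaCSC f g μy ε xs)))
              * logFactor f g Lty ρxy ρyy μy ε xs ^ 2
          ∧ ∀ K' M' N' : ℕ, K ≤ K' → M ≤ M' → N ≤ N' →
            totalObj f g
                (accBiO (regularize f ε (B ^ 2)) g Lty μy
                  (regSmoothness f g Lx Lxy Ly Ltxy ρxy ρyy μy ε (B ^ 2) (ε / 2))
                  (ε / B ^ 2) M' N' K').z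
              - totalObj f g xs ≤ ε)
        ∧
        -- gradient norm: R = B, accuracy ε²/(4L + 8ε/B) with L the parameter itself, μx = ε/B
        (∃! L : ℝ, L = regSmoothness f g Lx Lxy Ly Ltxy ρxy ρyy μy ε B
            (ε ^ 2 / (4 * L + 8 * ε / B)))
        ∧
        (∀ L : ℝ, L = regSmoothness f g Lx Lxy Ly Ltxy ρxy ρyy μy ε B
            (ε ^ 2 / (4 * L + 8 * ε / B)) →
          ∃ K M N : ℕ,
            (accBiO (regularize f ε B) g Lty μy L (ε / B) M N K).count.cost τ
              ≤ C * (Real.sqrt (B * Lty / (ε * μy ^ 3))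
                  + (Real.sqrt (B * ρyy * Lty / (ε * μy ^ 4))
                      + Real.sqrt (B * ρxy * Lty / (ε * μy ^ 3)))
                    * Real.sqrt (deltaCSC f g μy ε xs))
                * logFactor f g Lty ρxy ρyy μy ε xs ^ 2
            ∧ ∀ K' M' N' : ℕ, K ≤ K' → M ≤ M' → N ≤ N' →
              DifferentiableAt ℝ (totalObj f g)
                  (accBiO (regularize f ε B) g Lty μy L (ε / B) M' N' K').z
                ∧ ‖gradient (totalObj f g)
                  (accBiO (regularize f ε B) g Lty μy L (ε / B) M' N' K').z‖ ≤ 5 * ε) := by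
  set c := 1 + Lx + Lxy + Ly + Ltxy + μbar
  refine ⟨complexityConst c τ, complexityConst_pos (by linarith) hτ, ?_⟩
  rintro p q f g Lty ρxy ρyy μ B ε xs hq - hρxy hρyy hμ hμ_le hB hε hclass hmin rfl
  have hbilevel : BilevelProblem f g Lx Lxy Ly Ltxy Lty ρxy ρyy μ :=
    { __ := hclass
      Lx_nonneg := hLx
      Lxy_nonneg := hLxy
      Ly_nonneg := hLy
      Ltxy_nonneg := hLtxy
      ρxy_nonneg := hρxy
      ρyy_nonneg := hρyy
      μ_pos := hμ
      μ_le_Lty := hclass.μ_le_Lty hq }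
  have hc : 1 + Lx + Lxy + Ly + Ltxy + μ ≤ c := add_le_add_right hμ_le _
  have hxs (u : Euc p) : totalObj f g xs ≤ totalObj f g u := hmin (mem_univ u)
  refine ⟨hbilevel.exists_accBiO_gap_le hc hτ hε hB hxs,
    hbilevel.existsUnique_eq_regSmoothness hε hB, fun L hL => ?_⟩
  obtain ⟨K, M, N, hcost, hgrad⟩ :=
    hbilevel.exists_accBiO_norm_gradient_le hc hτ hε hB hxs hL
  exact ⟨K, M, N, hcost, fun K' M' N' hK hM hN =>
    (hgrad K' M' N' hK hM hN).imp_right fun hle => hle.trans (by linarith)⟩
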